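/- Let $d\ge 1$, $T^d=\{x\in\mathbb R^d: x_1,\dots,x_d\ge 0,\ x_{d+1}\ge 0\}$ with $x_{d+1}:=1-(x_1+\cdots+x_d)$. For $\boldsymbol\gamma=(\gamma_1,\dots,\gamma_{d+1})\in\mathbb R^{d+1}$ put $|\boldsymbol\gamma|=\gamma_1+\cdots+\gamma_{d+1}$, $W_{\boldsymbol\gamma}(x)=\prod_{i=1}^{d+1}x_i^{\gamma_i}$, and $$L_{\boldsymbol\gamma}u=\sum_{i=1}^d x_i(1-x_i)\partial_i^2u-2\sum_{1\le i<j\le d}x_ix_j\,\partial_i\partial_j u+\sum_{i=1}^d\bigl(\gamma_i+1-(|\boldsymbol\gamma|+d+1)x_i\bigr)\partial_i u .$$ If all $\gamma_i>-1$, let $\mathcal V_N^d(W_{\boldsymbol\gamma})$ be the space of real polynomials of total degree at most $N$ that are orthogonal to every polynomial of total degree at most $N-1$ with respect to $W_{\boldsymbol\gamma}\,dx$ on $T^d$; it is $\{0\}$ for $N<0$. For $S\subsetneq\{1,\dots,d+1\}$ and a chosen index $m\notin S$, let $\mathcal H_{N,S}^d(W_{\boldsymbol\gamma})$ be the span of the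 polynomials given on the interior of $T^d$ by the Rodrigues formula $$P_\nu(x)=\prod_{i=1}^{d+1}x_i^{-\gamma_i}\;\prod_{i\ne m}D_i^{\nu_i}\Bigl[x_m^{\gamma_m+|\nu|}\prod_{i\ne m}x_i^{\gamma_i+\nu_i}\Bigr],$$ over all multi-indices $\nu=(\nu_i)_{i\ne m}$ of nonnegative integers with $|\nu|=N$ and $\nu_i=0$ for $i\in S$; the span is $\{0\}$ if there are none, in particular if $N<0$. Here $D_i$ is the derivative in the direction $e_i-e_m$, where $e_1,\dots,e_d$ is the standard basis of $\mathbb R^d$ and $e_{d+1}:=0$ (so $D_i=\partial_i$ if $m=d+1$). Let $1\le k\le d+1$, $\gamma=(\gamma_1,\dots,\gamma_{d+1-k})$ with all $\gamma_i>-1$, $|\gamma|=\sum_i\gamma_i$, and $n\ge 0$ an integer. Write $K=\{d+2-k,\dots,d+1\}$, and $(\gamma,-\mathbf 1_k)$, $(\gamma,\mathbf 1_k)$ for the vectors in $\mathbb R^{d+1}$ that extend $\gamma$ by $k$ entries $-1$, respectively $1$. For $A\subseteq K$ let $x_A=\prod_{i\in A}x_i$, and let $(\gamma,\mathbf 1_A)\in\mathbb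 R^{d+1}$ extend $\gamma$ by entries $1$ at the indices in $A$ and $0$ at those in $K\setminus A$. For every choice of the eliminated indices $m=m(S)\notin S$ and all real $c_1,\dots,c_d$, the equation $$L_{(\gamma,-\mathbf 1_k)}u=-n(n+|\gamma|+d-k)\,u$$ has a linear space $\mathcal U_n^d$ of polynomial solutions, whose nonzero elements all have total degree exactly $n$, with $\dim\mathcal U_n^d=\binom{n+d-1}{n}$; unless $k=d+1$ and $n\le 1$, it contains every polynomial solution. It is given explicitly as follows. * $\mathcal U_0^d=\mathrm{span}\{1\}$. * If $1\le k\le d$ and $n\ge 1$, then, as a direct sum, $$\mathcal U_n^d=\Bigl(\prod_{i\in K}x_i\Bigr)\mathcal V_{n-k}^d(W_{\gamma,\mathbf 1_k})\oplus\bigoplus_{A\subsetneq K}x_A\,\mathcal H_{n-|A|,\,K\setminus A}^d(W_{\gamma,\mathbf 1_A}).$$ The term $A=\emptyset$ is $\mathcal H_{n,K}^d(W_{\gamma,\mathbf 0_k})$; for $k=1$ the sum is $x_{d+1}\mathcal V_{n-1}^d(W_{\gamma,1})\oplus\mathcal H_{n,\{d+1\}}^d(W_{\gamma,0})$. * If $k=d+1$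 and $n=1$, then $\mathcal U_1^d=\mathrm{span}\{x_1+c_1,\dots,x_d+c_d\}$. * If $k=d+1$ and $n\ge 2$, then, as a direct sum, with $K=\{1,\dots,d+1\}$, $$\mathcal U_n^d=x_1\cdots x_{d+1}\,\mathcal V_{n-d-1}^d(W_{\mathbf 1})\oplus\bigoplus_{\substack{A\subsetneq K\\ |A|\ge 2}}x_A\,\mathcal H_{n-|A|,\,K\setminus A}^d(W_{\mathbf 1_A}).$$ -/

import Mathlib

open MvPolynomial MeasureTheory

noncomputable section

namespace SimplexPoly

/-- The coordinates `(x₁, …, x_d, x_{d+1})` of a point, where `x_{d+1} = 1 - |x|`.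
Index `i : Fin d` is `i.castSucc`, and the last index of `Fin (d + 1)` is `x_{d+1}`. -/
def bary {d : ℕ} (x : Fin d → ℝ) : Fin (d + 1) → ℝ :=
  Fin.snoc (α := fun _ => ℝ) x (1 - ∑ i, x i)

/-- The same coordinates as polynomials in `x₁, …, x_d`. -/
def baryPoly {d : ℕ} : Fin (d + 1) → MvPolynomial (Fin d) ℝ :=
  Fin.snoc (α := fun _ => MvPolynomial (Fin d) ℝ) (fun i => X i) (1 - ∑ i, X i)

/-- The vertices of the simplex: `e₁, …, e_d` and, at the last index, the origin. -/
def vertex {d : ℕ} : Fin (d + 1) → (Fin d → ℝ) :=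
  Fin.snoc (α := fun _ => Fin d → ℝ) (fun i => Pi.single i 1) 0

/-- The simplex `T^d`. -/
def simplex (d : ℕ) : Set (Fin d → ℝ) := {x | ∀ i, 0 ≤ bary x i}

/-- The interior of the simplex, on which all real powers below have positive base. -/
def openSimplex (d : ℕ) : Set (Fin d → ℝ) := {x | ∀ i, 0 < bary x i}

/-- The weight `x₁^{γ₁} ⋯ x_d^{γ_d} (1 - |x|)^{γ_{d+1}}`. -/
def weight {d : ℕ} (γ : Fin (d + 1) → ℝ) (x : Fin d → ℝ) : ℝ := ∏ i, bary x i ^ γ i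

/-- The second order differential operator `L_γ`, acting on polynomials. -/
def diffOp {d : ℕ} (γ : Fin (d + 1) → ℝ) (u : MvPolynomial (Fin d) ℝ) :
    MvPolynomial (Fin d) ℝ :=
  (∑ i, X i * (1 - X i) * pderiv i (pderiv i u))
    - 2 * (∑ i, ∑ j ∈ Finset.Ioi i, X i * X j * pderiv i (pderiv j u))
    + ∑ i, (C (γ i.castSucc + 1) - C ((∑ l, γ l) + d + 1) * X i) * pderiv i u

/-- Polynomials of total degree at most `N`; for `N < 0` only the zero polynomial. -/
def polyLE (d : ℕ) (N : ℤ) : Submodule ℝ (MvPolynomial (Fin d) ℝ) :=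
  restrictSupport ℝ {m : Fin d →₀ ℕ | (m.degree : ℤ) ≤ N}

/-- The space `V_N^d(W_γ)` of orthogonal polynomials of degree `N` on the simplex: polynomials of
degree at most `N` orthogonal to all polynomials of degree at most `N - 1` with respect to `W_γ`.
When all `γ_i > -1` all integrals converge, the set is closed under linear combinations and `span`
adds nothing. The space is zero when `N < 0`. -/
def orthoSpace {d : ℕ} (γ : Fin (d + 1) → ℝ) (N : ℤ) :
    Submodule ℝ (MvPolynomial (Fin d) ℝ) :=
  Submodule.span ℝ {p | p ∈ polyLE d N ∧ ∀ q ∈ polyLE d (N - 1),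
    ∫ x in simplex d, eval x p * eval x q * weight γ x = 0}

/-- Directional derivative of a function, again as a function. -/
def dirDeriv {d : ℕ} (v : Fin d → ℝ) (f : (Fin d → ℝ) → ℝ) : (Fin d → ℝ) → ℝ :=
  fun x => lineDeriv ℝ f x v

/-- The iterated derivative `∏ᵢ D_i^{ν i}`, where `D_i` is the derivative along the edge from vertex
`m` to vertex `i`. For `m` the last index, `D_i = ∂_i`; for `m ≤ d`, `D_i = ∂_i - ∂_m` when
`i ≤ d` and `D_{d+1} = - ∂_m`. -/
def edgeDeriv {d : ℕ} (m : Fin (d + 1)) (ν : Fin (d + 1) → ℕ) (f : (Fin d → ℝ) → ℝ) :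
    (Fin d → ℝ) → ℝ :=
  (List.finRange (d + 1)).foldr (fun i g => (dirDeriv (vertex i - vertex m))^[ν i] g) f

/-- The Rodrigues formula, with `m` the index whose coordinate is eliminated (used with `ν m = 0`):
`∏ᵢ x_i^{-γ_i} · D^ν [ ∏_{i ≠ m} x_i^{γ_i + ν_i} · x_m^{γ_m + |ν|} ]`. -/
def rodrigues {d : ℕ} (γ : Fin (d + 1) → ℝ) (m : Fin (d + 1)) (ν : Fin (d + 1) → ℕ)
    (x : Fin d → ℝ) : ℝ :=
  weight (fun i => - γ i) x *
    edgeDeriv m ν (weight (fun i => γ i + (if i = m then ((∑ l, ν l : ℕ) : ℝ) else (ν i : ℝ)))) x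

/-- The face space `H_{N,S}^d(W_γ)`: the span of the Rodrigues polynomials of degree `N` with
eliminated index `m ∉ S` whose multi-index vanishes on `S`. It is zero when `N < 0`, and also when
`|S| = d` and `N ≥ 1`. -/
def faceSpace {d : ℕ} (γ : Fin (d + 1) → ℝ) (m : Fin (d + 1)) (S : Finset (Fin (d + 1)))
    (N : ℤ) : Submodule ℝ (MvPolynomial (Fin d) ℝ) :=
  Submodule.span ℝ {q | ∃ ν : Fin (d + 1) → ℕ, ν m = 0 ∧ (∀ i ∈ S, ν i = 0) ∧
    ((∑ i, ν i : ℕ) : ℤ) = N ∧ ∀ x ∈ openSimplex d, eval x q = rodrigues γ m ν x}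

/-- The last `k` of the `d + 1` indices. -/
def tail (d k : ℕ) : Finset (Fin (d + 1)) := Finset.univ.filter fun i => d + 1 - k ≤ (i : ℕ)

/-- The vector `(γ, ε)` in `ℝ^{d+1}`: the first `d + 1 - k` entries are those of `γ`, the last `k`
entries are those of `ε` at the same positions. -/
def withTail {d k : ℕ} (γ : Fin (d + 1 - k) → ℝ) (ε : Fin (d + 1) → ℝ) : Fin (d + 1) → ℝ :=
  fun i => if h : (i : ℕ) < d + 1 - k then γ ⟨i, h⟩ else ε i

/-- The summand of the decomposition attached to a set `A` of tail indices: the product of the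
coordinates `x_i`, `i ∈ A`, times
* the space `V_{n-k}^d(W_{γ,1})` if `A` is the whole tail,
* the face space `H_{n-|A|}^d(W_{γ,ε})` otherwise, where `ε` is `1` on `A` and `0` on the set `S` of
  the other tail indices, and `p S` is the index eliminated in the Rodrigues formula. -/
def summand (d k : ℕ) (γ : Fin (d + 1 - k) → ℝ) (p : Finset (Fin (d + 1)) → Fin (d + 1))
    (n : ℕ) (A : Finset (Fin (d + 1))) : Submodule ℝ (MvPolynomial (Fin d) ℝ) :=
  Submodule.map (LinearMap.mulLeft ℝ (∏ i ∈ A, baryPoly i))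
    (if A = tail d k then orthoSpace (withTail γ fun _ => 1) ((n : ℤ) - k)
     else faceSpace (withTail γ fun i => if i ∈ A then 1 else 0) (p (tail d k \ A))
       (tail d k \ A) ((n : ℤ) - A.card))

end SimplexPoly

end

/-!
Write `y_1, …, y_{d+1}` for independent variables and put
`Δ_κ = ∑ (y_i ∂_i² + (κ_i + 1) ∂_i)` (`lapOp`). Restriction to the hyperplane `∑ y_i = 1` identifies
homogeneous polynomials of degree `N` in the `y_i` with polynomials of degree at most `N` in
`x_1, …, x_d`, and Euler's identity turns `L_κ` into `Δ_κ - N (N + |κ| + d)` under this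
identification (`diffOp_onSimplex`). Since `Δ_κ` lowers the degree, an eigenfunction of `L_κ` of
degree `N` has the eigenvalue `-N (N + |κ| + d)`; these are distinct for distinct degrees except for
the degrees `0` and `1` when all `κ_i = -1`. Hence the solution space is the restriction of the space
`harmonic κ n` of homogeneous polynomials of degree `n` killed by `Δ_κ`. Its dimension comes from
rank-nullity and from the fact that no nonzero harmonic polynomial is a multiple of `∑ y_i`
(`harmonic_sup_and_finrank`).

If `κ_i = -1` for `i ∈ K`, then `y_i ∂_i²` kills `y_i`, so `Δ_κ` does not change which of the
variables `y_i`, `i ∈ K`, occur in a monomial. The harmonic polynomials therefore split according to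
the set `A ⊆ K` of variables of `K` that occur (`harmonicPiece`), which is the direct sum of the
theorem. The piece of `A` is `∏_{i ∈ A} y_i` times the harmonic polynomials for the parameters
`(γ, 1_A)` in the variables outside `K \ A` (`harmonicPiece_eq_map`), because
`Δ_{-1} (y G) = y Δ_1 G` in each variable.

It remains to identify these factors.

* Face spaces (`faceSpace_eq_map`). If `δ_m > -1`, a harmonic polynomial is determined by its residue
  modulo `y_m`. The first order operator `edgeOp δ i m`, which describes the derivative along an edge
  of a weight times a polynomial, maps harmonic polynomials to harmonic polynomials and acts modulo
  `y_m` as multiplication by a nonzero multiple of `y_i`. So the Rodrigues polynomial of `ν` is, up to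
  a factor, the harmonic polynomial congruent to `y^ν` modulo `y_m`, and every harmonic polynomial is
  a combination of these.

* Orthogonal polynomials (`orthoSpace_eq_map`). On homogeneous polynomials of a given degree,
  integration over the simplex against the weight is a multiple of the functional with moments
  `∏ Γ(δ_i + b_i + 1)`, obtained by integrating against `∏ y_i^{δ_i} e^{-y_i}` over the orthant. For
  this functional `F Δ G - G Δ F` integrates to `(deg G - deg F)` times the integral of `F G`, so a
  harmonic polynomial is orthogonal to everything of lower degree, by induction on the degree.
-/

noncomputable section

namespace SimplexPoly

variable {d : ℕ}

/-! ### The operator in homogeneous coordinates -/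

section Laplacian

variable {σ : Type*} [Fintype σ]

/-- The operator `Δ_κ = ∑ (y_i ∂_i² + (κ_i + 1) ∂_i)` on polynomials in independent variables `y_i`. -/
def lapOp (κ : σ → ℝ) : MvPolynomial σ ℝ →ₗ[ℝ] MvPolynomial σ ℝ :=
  ∑ i, (LinearMap.mulLeft ℝ (X i) ∘ₗ (pderiv i).toLinearMap ∘ₗ (pderiv i).toLinearMap +
    (κ i + 1) • (pderiv i).toLinearMap)

theorem lapOp_apply (κ : σ → ℝ) (F : MvPolynomial σ ℝ) :
    lapOp κ F = ∑ i, (X i * pderiv i (pderiv i F) + C (κ i + 1) * pderiv i F) := by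
  simp [lapOp, LinearMap.sum_apply, smul_eq_C_mul]

theorem coeff_lapOp (κ : σ → ℝ) (F : MvPolynomial σ ℝ) (b : σ →₀ ℕ) :
    coeff b (lapOp κ F) =
      ∑ i, (b i + 1 : ℝ) * (b i + 1 + κ i) * coeff (b + Finsupp.single i 1) F := by
  classical
  rw [lapOp_apply, coeff_sum]
  refine Finset.sum_congr rfl fun i _ => ?_
  rw [coeff_add, coeff_C_mul, coeff_X_mul', coeff_pderiv]
  split_ifs with h
  · have hb : b i ≠ 0 := by simpa using h
    have hle : Finsupp.single i 1 ≤ b := by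
      simpa [Nat.one_le_iff_ne_zero] using hb
    rw [coeff_pderiv, coeff_pderiv, tsub_add_cancel_of_le hle]
    have : (((b - Finsupp.single i 1 : σ →₀ ℕ) i : ℕ) : ℝ) = b i - 1 := by
      simp [Nat.cast_sub (Nat.one_le_iff_ne_zero.2 hb)]
    rw [this]; ring
  · have hb : b i = 0 := by simpa using h
    rw [coeff_pderiv, hb]; push_cast; ring

theorem isHomogeneous_lapOp {κ : σ → ℝ} {F : MvPolynomial σ ℝ} {n : ℕ}
    (hF : F.IsHomogeneous (n + 1)) : (lapOp κ F).IsHomogeneous n := by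
  intro b hb
  by_contra hne
  apply hb
  rw [coeff_lapOp]
  refine Finset.sum_eq_zero fun i _ => ?_
  rw [hF.coeff_eq_zero, mul_zero]
  rw [map_add, Finsupp.degree_single]
  intro h
  apply hne
  change Finsupp.weight (fun _ => 1) b = n
  rw [← Finsupp.degree_eq_weight_one]; omega

theorem lapOp_eq_zero_of_isHomogeneous_zero {κ : σ → ℝ} {F : MvPolynomial σ ℝ}
    (hF : F.IsHomogeneous 0) : lapOp κ F = 0 := by
  ext b
  rw [coeff_lapOp, coeff_zero]
  refine Finset.sum_eq_zero fun i _ => ?_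
  rw [hF.coeff_eq_zero, mul_zero]
  rw [map_add, Finsupp.degree_single]; omega

/-- The homogeneous polynomials of degree `n` killed by `Δ_κ`. -/
def harmonic (κ : σ → ℝ) (n : ℕ) : Submodule ℝ (MvPolynomial σ ℝ) :=
  homogeneousSubmodule σ ℝ n ⊓ LinearMap.ker (lapOp κ)

theorem mem_harmonic {κ : σ → ℝ} {n : ℕ} {F : MvPolynomial σ ℝ} :
    F ∈ harmonic κ n ↔ F.IsHomogeneous n ∧ lapOp κ F = 0 := Iff.rfl

end Laplacian

/-! ### Restriction to the simplex -/

/-- Restriction of a polynomial in `d + 1` independent variables to the hyperplane on which they sum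
to one, in the coordinates `x₁, …, x_d`. -/
def onSimplex : MvPolynomial (Fin (d + 1)) ℝ →ₐ[ℝ] MvPolynomial (Fin d) ℝ := aeval baryPoly

@[simp] theorem baryPoly_castSucc (i : Fin d) : baryPoly i.castSucc = X i := by
  simp [baryPoly]

@[simp] theorem baryPoly_last :
    baryPoly (Fin.last d) = 1 - ∑ i, (X i : MvPolynomial (Fin d) ℝ) := by
  simp [baryPoly]

@[simp] theorem onSimplex_X (i : Fin (d + 1)) : onSimplex (X i) = baryPoly i := by
  simp [onSimplex]

@[simp] theorem onSimplex_C (r : ℝ) : onSimplex (d := d) (C r) = C r := by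
  simp [onSimplex]

theorem onSimplex_sum_X : onSimplex (∑ i : Fin (d + 1), X i) = 1 := by
  simp [Fin.sum_univ_castSucc]

theorem eval_baryPoly (x : Fin d → ℝ) (i : Fin (d + 1)) : eval x (baryPoly i) = bary x i := by
  refine Fin.lastCases ?_ (fun j => ?_) i <;> simp [bary]

theorem sum_bary (x : Fin d → ℝ) : ∑ i, bary x i = 1 := by
  simp [Fin.sum_univ_castSucc, bary]

theorem eval_onSimplex (x : Fin d → ℝ) (F : MvPolynomial (Fin (d + 1)) ℝ) :
    eval x (onSimplex F) = eval (bary x) F := by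
  rw [onSimplex, ← coe_aeval_eq_eval, ← coe_aeval_eq_eval, RingHom.coe_coe, RingHom.coe_coe,
    ← AlgHom.comp_apply, comp_aeval]
  congr 2
  ext i
  simp [← eval_baryPoly]

theorem pderiv_onSimplex (i : Fin d) (F : MvPolynomial (Fin (d + 1)) ℝ) :
    pderiv i (onSimplex F) = onSimplex (pderiv i.castSucc F - pderiv (Fin.last d) F) := by
  induction F using MvPolynomial.induction_on with
  | C a => simp
  | add p q hp hq => simp only [map_add, hp, hq, map_sub]; ring
  | mul_X p j h =>
    have hX : pderiv i (baryPoly j : MvPolynomial (Fin d) ℝ) =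
        onSimplex (pderiv i.castSucc (X j) - pderiv (Fin.last d) (X j)) := by
      refine Fin.lastCases ?_ (fun j => ?_) j
      · simp [Pi.single_apply, pderiv_X, (Fin.castSucc_ne_last i).symm]
      · simp [Pi.single_apply, pderiv_X, Fin.castSucc_ne_last, apply_ite]
    rw [map_mul, pderiv_mul, h, onSimplex_X, hX, pderiv_mul, pderiv_mul]
    simp only [map_sub, map_add, map_mul, onSimplex_X]
    ring

theorem totalDegree_baryPoly_le (i : Fin (d + 1)) :
    (baryPoly i : MvPolynomial (Fin d) ℝ).totalDegree ≤ 1 := by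
  refine Fin.lastCases ?_ (fun j => ?_) i
  · rw [baryPoly_last]
    refine (totalDegree_sub _ _).trans (max_le (by simp) ?_)
    refine totalDegree_finsetSum_le fun i _ => by simp
  · simp

theorem totalDegree_onSimplex_le (F : MvPolynomial (Fin (d + 1)) ℝ) :
    (onSimplex F).totalDegree ≤ F.totalDegree := by
  rw [onSimplex, aeval_def, eval₂_eq']
  refine totalDegree_finsetSum_le fun b hb => ?_
  refine (totalDegree_mul _ _).trans ?_
  rw [algebraMap_eq, totalDegree_C, zero_add]
  refine (totalDegree_finsetProd _ _).trans ?_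
  refine le_trans ?_ (le_totalDegree hb)
  rw [Finsupp.sum_fintype _ _ (by simp)]
  refine Finset.sum_le_sum fun i _ => ?_
  refine (totalDegree_pow _ _).trans ?_
  simpa using Nat.mul_le_mul_left (b i) (totalDegree_baryPoly_le i)

/-- A polynomial of degree at most `N` is the restriction of a homogeneous one of degree `N`: each
monomial is multiplied by a power of the sum of the variables, which restricts to `1`. -/
theorem exists_isHomogeneous_onSimplex {u : MvPolynomial (Fin d) ℝ} {N : ℕ}
    (hu : u.totalDegree ≤ N) :
    ∃ F : MvPolynomial (Fin (d + 1)) ℝ, F.IsHomogeneous N ∧ onSimplex F = u := by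
  refine ⟨∑ b ∈ u.support, rename Fin.castSucc (monomial b (coeff b u)) *
    (∑ i, X i) ^ (N - b.degree), ?_, ?_⟩
  · refine IsHomogeneous.sum _ _ _ fun b hb => ?_
    have hb' : b.degree ≤ N := by
      refine le_trans ?_ hu
      exact le_totalDegree hb
    have h1 : (rename (Fin.castSucc : Fin d → Fin (d + 1))
        (monomial b (coeff b u))).IsHomogeneous b.degree :=
      (isHomogeneous_monomial _ rfl).rename_isHomogeneous
    have h2 : ((∑ i : Fin (d + 1), (X i : MvPolynomial (Fin (d + 1)) ℝ)) ^
        (N - b.degree)).IsHomogeneous (1 * (N - b.degree)) :=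
      (IsHomogeneous.sum _ _ _ fun i _ => isHomogeneous_X ℝ i).pow _
    have := h1.mul h2
    rwa [one_mul, Nat.add_sub_cancel' hb'] at this
  · have hr : ∀ p : MvPolynomial (Fin d) ℝ, onSimplex (rename Fin.castSucc p) = p := by
      intro p
      rw [onSimplex, aeval_rename]
      have : (baryPoly ∘ Fin.castSucc : Fin d → MvPolynomial (Fin d) ℝ) = X := by
        ext1 i; simp
      rw [this, aeval_X_left_apply]
    simp only [map_sum, map_mul, map_pow, hr]
    conv_rhs => rw [u.as_sum]
    refine Finset.sum_congr rfl fun b _ => ?_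
    rw [← map_sum, onSimplex_sum_X, one_pow, mul_one]

/-- Restriction is injective on homogeneous polynomials of a given degree. -/
theorem eq_zero_of_onSimplex_eq_zero {F : MvPolynomial (Fin (d + 1)) ℝ} {N : ℕ}
    (hF : F.IsHomogeneous N) (h : onSimplex F = 0) : F = 0 := by
  -- `F` vanishes at all points whose coordinate sum is nonzero, by rescaling
  have key : (∑ i, X i) * F = 0 := by
    refine MvPolynomial.funext fun y => ?_
    rw [map_mul, map_zero, map_sum]
    simp only [eval_X]
    by_cases hs : ∑ i, y i = 0
    · rw [hs, zero_mul]
    · set s := ∑ i, y i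
      have hy : y = s • bary (fun i : Fin d => y i.castSucc / s) := by
        ext j
        refine Fin.lastCases ?_ (fun j => ?_) j
        · have : s = ∑ i : Fin d, y i.castSucc + y (Fin.last d) := Fin.sum_univ_castSucc _
          simp [bary, ← Finset.sum_div, mul_sub, mul_div_cancel₀ _ hs]
          linarith
        · simp [bary, mul_div_cancel₀ _ hs]
      have hev : eval y F = s ^ N * eval (bary fun i : Fin d => y i.castSucc / s) F := by
        conv_lhs => rw [hy]
        rw [eval_eq', eval_eq', Finset.mul_sum]
        refine Finset.sum_congr rfl fun b hb => ?_
        have hb' : ∑ i, b i = N := by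
          have := hF.degree_eq_sum_deg_support hb
          rw [this]
          exact (Finset.sum_subset (Finset.subset_univ _) fun i _ hi => by simpa using hi).symm
        simp only [Pi.smul_apply, smul_eq_mul, mul_pow, Finset.prod_mul_distrib,
          Finset.prod_pow_eq_pow_sum, hb']
        ring
      rw [hev, ← eval_onSimplex, h, map_zero, mul_zero, mul_zero]
  refine (mul_eq_zero.1 key).resolve_left fun h0 => ?_
  have := congrArg onSimplex h0
  rw [onSimplex_sum_X, map_zero] at this
  exact one_ne_zero this

theorem pderiv_comm {τ : Type*} (i j : τ) (F : MvPolynomial τ ℝ) :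
    pderiv i (pderiv j F) = pderiv j (pderiv i F) := by
  classical
  ext b
  simp only [coeff_pderiv]
  rcases eq_or_ne i j with rfl | h
  · rfl
  · simp [h, h.symm, add_right_comm]
    ring

theorem sum_offdiag_eq {M : Type*} [AddCommGroup M] (a : Fin d → Fin d → M)
    (ha : ∀ i j, a i j = a j i) :
    ∑ i, ∑ j, a i j = ∑ i, a i i + 2 • ∑ i, ∑ j ∈ Finset.Ioi i, a i j := by
  have h := Finset.sum_sum_Ioi_add_eq_sum_sum_off_diag a
  have h2 : ∀ i, ∑ j, a i j = a i i + ∑ j ∈ {i}ᶜ, a j i := by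
    intro i
    rw [← Finset.add_sum_erase _ _ (Finset.mem_univ i), Finset.compl_singleton]
    simp only [ha i]
  simp only [h2, Finset.sum_add_distrib, ← h, Finset.smul_sum, two_nsmul]
  simp only [ha]

/-- The algebra behind `diffOp_onSimplex`. Here `x` stands for the coordinates `x₁, …, x_d`, `g` and
`g₀` for the first derivatives of a homogeneous polynomial `f` in the first `d` variables and in the
last one, `a`, `b` and `w` for the second derivatives (both among the first `d`, mixed with the last
one, twice the last one), and `e1`, `e2` are Euler's identities of first and second order. -/
theorem secondOrder_identity {R : Type*} [CommRing R] (x b g k : Fin d → R)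
    (a : Fin d → Fin d → R) (w g₀ f c k₀ N : R)
    (e1 : ∑ i, x i * g i + (1 - ∑ i, x i) * g₀ = N * f)
    (e2 : ∑ i, x i * (∑ j, x j * a j i + (1 - ∑ i, x i) * b i) +
      (1 - ∑ i, x i) * (∑ j, x j * b j + (1 - ∑ i, x i) * w) = (N - 1) * (N * f))
    (hκ : ∑ i, k i + k₀ = c) :
    ∑ i, x i * (a i i - b i - (b i - w)) - ∑ i, ∑ j, x i * x j * (a i j - b j - (b i - w)) +
        ∑ i, (k i - c * x i) * (g i - g₀) =
      ∑ i, (x i * a i i + k i * g i) + ((1 - ∑ i, x i) * w + k₀ * g₀) -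
        ((N - 1) * N + c * N) * f := by
  have hQ : ∑ i : Fin d, ∑ j : Fin d, x i * x j * (a i j - b j - (b i - w)) =
      ∑ i : Fin d, ∑ j : Fin d, x i * x j * a i j
        - 2 * ((∑ i, x i) * ∑ i, x i * b i) + (∑ i, x i) ^ 2 * w := by
    have h1 : ∀ i j : Fin d, x i * x j * (a i j - b j - (b i - w)) =
        x i * x j * a i j - x i * (x j * b j) - (x i * b i) * x j + x i * x j * w := by
      intro i j; ring
    simp only [h1, Finset.sum_add_distrib, Finset.sum_sub_distrib, ← Finset.sum_mul,
      ← Finset.mul_sum]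
    ring
  have hA : ∑ i : Fin d, x i * (a i i - b i - (b i - w)) =
      ∑ i : Fin d, x i * a i i - 2 * ∑ i, x i * b i + (∑ i, x i) * w := by
    have h1 : ∀ i : Fin d, x i * (a i i - b i - (b i - w)) =
        x i * a i i - 2 * (x i * b i) + x i * w := by
      intro i; ring
    simp only [h1, Finset.sum_add_distrib, Finset.sum_sub_distrib, ← Finset.sum_mul,
      ← Finset.mul_sum]
  have hK : ∑ i : Fin d, (k i - c * x i) * (g i - g₀) =
      ∑ i : Fin d, k i * g i - (∑ i : Fin d, k i) * g₀
        - c * (∑ i, x i * g i - (∑ i, x i) * g₀) := by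
    have h1 : ∀ i : Fin d, (k i - c * x i) * (g i - g₀) =
        k i * g i - k i * g₀
          - c * (x i * g i - x i * g₀) := by
      intro i; ring
    simp only [h1, Finset.sum_sub_distrib, ← Finset.sum_mul, ← Finset.mul_sum]
  have e2' : ∑ i : Fin d, x i * (∑ j : Fin d, x j * a j i + (1 - ∑ i, x i) * b i) =
      ∑ i : Fin d, ∑ j : Fin d, x i * x j * a i j
        + (1 - ∑ i, x i) * ∑ i, x i * b i := by
    simp only [mul_add, Finset.sum_add_distrib, Finset.mul_sum]
    rw [Finset.sum_comm]
    congr 1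
    · refine Finset.sum_congr rfl fun i _ => Finset.sum_congr rfl fun j _ => by ring
    · refine Finset.sum_congr rfl fun i _ => by ring
  rw [e2'] at e2
  rw [hA, hQ, hK, Finset.sum_add_distrib]
  linear_combination -e2 - c * e1 - g₀ * hκ

/-- On restrictions of homogeneous polynomials of degree `N`, the operator `L_κ` is `Δ_κ` plus a
scalar. -/
theorem diffOp_onSimplex {κ : Fin (d + 1) → ℝ} {F : MvPolynomial (Fin (d + 1)) ℝ} {N : ℕ}
    (hF : F.IsHomogeneous N) :
    diffOp κ (onSimplex F) =
      onSimplex (lapOp κ F) - C ((N : ℝ) * (N + ∑ i, κ i + d)) * onSimplex F := by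
  -- first and second order Euler identities
  have e1 : ∑ i, X i * pderiv i F = N * F := by
    simpa using hF.sum_X_mul_pderiv
  have e2 : ∑ i, X i * ∑ j, X j * pderiv j (pderiv i F) =
      ((N : MvPolynomial (Fin (d + 1)) ℝ) - 1) * ((N : MvPolynomial (Fin (d + 1)) ℝ) * F) := by
    rw [← e1, Finset.mul_sum]
    refine Finset.sum_congr rfl fun i _ => ?_
    have h := congrArg (pderiv i) e1
    rw [map_sum] at h
    simp only [pderiv_mul, pderiv_X, Finset.sum_add_distrib, pderiv_comm i] at h
    simp [Pi.single_apply] at h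
    rw [eq_sub_of_add_eq' h]
    ring
  set c : MvPolynomial (Fin d) ℝ := C ((∑ l, κ l) + d + 1) with hc
  have hκ : ∑ i : Fin d, C (κ i.castSucc + 1) + C (κ (Fin.last d) + 1) = c := by
    rw [hc, Fin.sum_univ_castSucc, ← map_sum, ← C_add, Finset.sum_add_distrib]
    congr 1
    simp
    ring
  have hN : (C ((N : ℝ) * (N + ∑ i, κ i + d)) : MvPolynomial (Fin d) ℝ) =
      ((N : MvPolynomial (Fin d) ℝ) - 1) * N + c * N := by
    have : ((N : MvPolynomial (Fin d) ℝ)) = C (N : ℝ) := by simp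
    rw [hc, this, ← C_1, ← C_sub, ← C_mul, ← C_mul, ← C_add]
    congr 1
    ring
  have h2 := sum_offdiag_eq (fun i j : Fin d => X i * X j * pderiv i (pderiv j (onSimplex F)))
    (fun i j => by rw [pderiv_comm, mul_comm (X i)])
  have hL : diffOp κ (onSimplex F) = ∑ i : Fin d, X i * pderiv i (pderiv i (onSimplex F))
      - ∑ i : Fin d, ∑ j : Fin d, X i * X j * pderiv i (pderiv j (onSimplex F))
      + ∑ i : Fin d, (C (κ i.castSucc + 1) - c * X i) * pderiv i (onSimplex F) := by
    rw [h2, diffOp, ← hc]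
    simp only [mul_sub, sub_mul, Finset.sum_sub_distrib, mul_one, two_nsmul]
    ring
  rw [hL, lapOp_apply, hN]
  replace e1 := congrArg onSimplex e1
  replace e2 := congrArg onSimplex e2
  simp only [map_mul, map_sum, onSimplex_X, Fin.sum_univ_castSucc, baryPoly_castSucc, baryPoly_last,
    map_add, map_sub, map_natCast, map_one, onSimplex_C, pderiv_onSimplex,
    fun i : Fin d => pderiv_comm i.castSucc (Fin.last d) F] at e1 e2 ⊢
  exact secondOrder_identity (fun i => X i)
    (fun i => onSimplex (pderiv (Fin.last d) (pderiv i.castSucc F)))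
    (fun i => onSimplex (pderiv i.castSucc F)) (fun i => C (κ i.castSucc) + 1)
    (fun i j => onSimplex (pderiv i.castSucc (pderiv j.castSucc F)))
    (onSimplex (pderiv (Fin.last d) (pderiv (Fin.last d) F)))
    (onSimplex (pderiv (Fin.last d) F)) (onSimplex F) c (C (κ (Fin.last d)) + 1) N e1 e2
    (by simpa only [map_add, map_one] using hκ)

/-! ### Eigenvalues, degrees and dimensions -/

/-- The eigenvalue of a polynomial eigenfunction of `L_κ` is determined by its degree `N`: modulo
polynomials of degree less than `N`, the operator acts as the scalar `-N (N + |κ| + d)`. -/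
theorem eigenvalue_eq_of_diffOp_eq {κ : Fin (d + 1) → ℝ} {u : MvPolynomial (Fin d) ℝ} {t : ℝ}
    (hu : u ≠ 0) (h : diffOp κ u = (-t) • u) :
    t = (u.totalDegree : ℝ) * (u.totalDegree + ∑ i, κ i + d) := by
  obtain ⟨F, hF, rfl⟩ := exists_isHomogeneous_onSimplex (le_refl u.totalDegree)
  set u := onSimplex F
  rw [diffOp_onSimplex hF, smul_eq_C_mul] at h
  set l := (u.totalDegree : ℝ) * (u.totalDegree + ∑ i, κ i + d)
  have h' : onSimplex (lapOp κ F) = C (l - t) * u := by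
    rw [C_sub, sub_mul, ← sub_eq_zero] at *
    rw [C_neg] at h
    linear_combination h
  by_contra hne
  have hlt : l - t ≠ 0 := sub_ne_zero.2 (Ne.symm hne)
  have hdeg : (C (l - t) * u).totalDegree = u.totalDegree := by
    rw [totalDegree_mul_of_isDomain (mt C_eq_zero.1 hlt) hu, totalDegree_C, zero_add]
  rcases hN : u.totalDegree with _ | M
  · rw [hN] at hF
    rw [lapOp_eq_zero_of_isHomogeneous_zero hF, map_zero] at h'
    rcases mul_eq_zero.1 h'.symm with h0 | h0
    · exact hlt (C_eq_zero.1 h0)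
    · exact hu h0
  · rw [hN] at hF
    have h1 := totalDegree_onSimplex_le (lapOp κ F)
    rw [h', hdeg] at h1
    have h2 := (isHomogeneous_lapOp (κ := κ) hF).totalDegree_le
    omega

theorem diffOp_of_mem_harmonic {κ : Fin (d + 1) → ℝ} {n : ℕ} {F : MvPolynomial (Fin (d + 1)) ℝ}
    (hF : F ∈ harmonic κ n) :
    diffOp κ (onSimplex F) = (-((n : ℝ) * (n + ∑ i, κ i + d))) • onSimplex F := by
  rw [diffOp_onSimplex hF.1, (mem_harmonic.1 hF).2, map_zero, smul_eq_C_mul, C_neg]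
  ring

theorem eq_of_eigenvalue_eq {s : ℝ} {n N : ℕ} (hres : N ≠ n → (n : ℝ) + N + s ≠ 0)
    (h : (n : ℝ) * (n + s) = N * (N + s)) : N = n := by
  by_contra hne
  have h0 : ((n : ℝ) - N) * (n + N + s) = 0 := by linear_combination h
  rcases mul_eq_zero.1 h0 with h1 | h1
  · exact hne (by exact_mod_cast (sub_eq_zero.1 h1).symm)
  · exact hres hne h1

theorem totalDegree_of_mem_harmonic {κ : Fin (d + 1) → ℝ} {n : ℕ}
    (hres : ∀ N < n, (n : ℝ) + N + (∑ i, κ i + d) ≠ 0)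
    {F : MvPolynomial (Fin (d + 1)) ℝ} (hF : F ∈ harmonic κ n) (h0 : onSimplex F ≠ 0) :
    (onSimplex F).totalDegree = n := by
  have hle : (onSimplex F).totalDegree ≤ n :=
    (totalDegree_onSimplex_le F).trans (mem_harmonic.1 hF).1.totalDegree_le
  have h := eigenvalue_eq_of_diffOp_eq h0 (diffOp_of_mem_harmonic hF)
  refine eq_of_eigenvalue_eq (s := ∑ i, κ i + d) (fun hne => hres _ (lt_of_le_of_ne hle hne)) ?_
  linear_combination h

theorem mem_map_harmonic_of_diffOp_eq {κ : Fin (d + 1) → ℝ} {n : ℕ}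
    (hres : ∀ N, N ≠ n → (n : ℝ) + N + (∑ i, κ i + d) ≠ 0) {u : MvPolynomial (Fin d) ℝ}
    (h : diffOp κ u = (-((n : ℝ) * (n + ∑ i, κ i + d))) • u) :
    u ∈ (harmonic κ n).map onSimplex.toLinearMap := by
  rcases eq_or_ne u 0 with rfl | hu
  · exact zero_mem _
  have hdeg : u.totalDegree = n := by
    refine eq_of_eigenvalue_eq (s := ∑ i, κ i + d) (hres _) ?_
    linear_combination eigenvalue_eq_of_diffOp_eq hu h
  obtain ⟨F, hF, rfl⟩ := exists_isHomogeneous_onSimplex hdeg.le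
  refine ⟨F, ⟨hF, ?_⟩, rfl⟩
  rw [diffOp_onSimplex hF, smul_eq_C_mul, C_neg] at h
  have h0 : onSimplex (lapOp κ F) = 0 := by linear_combination h
  rcases n with _ | n
  · exact lapOp_eq_zero_of_isHomogeneous_zero hF
  · exact eq_zero_of_onSimplex_eq_zero (isHomogeneous_lapOp hF) h0

theorem finrank_homogeneousSubmodule (m n : ℕ) :
    Module.finrank ℝ (homogeneousSubmodule (Fin m) ℝ n) = m.multichoose n := by
  have h : homogeneousSubmodule (Fin m) ℝ n =
      restrictSupport ℝ {b : Fin m →₀ ℕ | b.degree = n} :=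
    homogeneousSubmodule_eq_finsupp_supported _ _ _
  have hs : {b : Fin m →₀ ℕ | b.degree = n} =
      ↑(Finset.univ.finsuppAntidiag n : Finset (Fin m →₀ ℕ)) := by
    ext b
    simp [Finset.mem_finsuppAntidiag, Finsupp.degree_eq_sum]
  rw [h, Module.finrank_eq_nat_card_basis (basisRestrictSupport ℝ _), hs]
  rw [Nat.card_coe_set_eq, Set.ncard_coe_finset, Finset.card_finsuppAntidiag_nat_eq_multichoose,
    Finset.card_fin]

instance (m n : ℕ) : FiniteDimensional ℝ (homogeneousSubmodule (Fin m) ℝ n) :=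
  Module.Finite.iff_fg.2 (homogeneousSubmodule_fg _ _ n)

instance (κ : Fin d → ℝ) (n : ℕ) : FiniteDimensional ℝ (harmonic κ n) :=
  Submodule.finiteDimensional_of_le inf_le_left

/-- If the eigenvalue of degree `n + 1` differs from those of lower degrees, then every homogeneous
polynomial of degree `n + 1` is a harmonic one plus a multiple of the sum of the variables. A
harmonic multiple of that sum would restrict to an eigenfunction of degree at most `n`, so the sum
is direct; rank-nullity for `Δ_κ` shows that the dimensions add up. -/
theorem harmonic_sup_and_finrank {κ : Fin (d + 1) → ℝ} {n : ℕ}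
    (hres : ∀ N < n + 1, ((n + 1 : ℕ) : ℝ) + N + (∑ i, κ i + d) ≠ 0) :
    harmonic κ (n + 1) ⊔ (homogeneousSubmodule (Fin (d + 1)) ℝ n).map
        (LinearMap.mulLeft ℝ (∑ i, X i)) = homogeneousSubmodule (Fin (d + 1)) ℝ (n + 1) ∧
      Module.finrank ℝ (harmonic κ (n + 1)) = d.multichoose (n + 1) := by
  set S := (homogeneousSubmodule (Fin (d + 1)) ℝ n).map
    (LinearMap.mulLeft ℝ (∑ i, X i : MvPolynomial (Fin (d + 1)) ℝ)) with hS
  set V := homogeneousSubmodule (Fin (d + 1)) ℝ (n + 1)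
  have hSV : S ≤ V := by
    rintro _ ⟨G, hG, rfl⟩
    have := (IsHomogeneous.sum Finset.univ _ _ fun i _ =>
      isHomogeneous_X ℝ (i : Fin (d + 1))).mul ((mem_homogeneousSubmodule _ _).1 hG)
    rwa [add_comm 1 n] at this
  have hHV : harmonic κ (n + 1) ≤ V := inf_le_left
  have hdisj : harmonic κ (n + 1) ⊓ S = ⊥ := by
    rw [eq_bot_iff]
    rintro _ ⟨hF, G, hG, rfl⟩
    have hφ : onSimplex (LinearMap.mulLeft ℝ (∑ i, X i) G) = onSimplex G := by
      rw [LinearMap.mulLeft_apply, map_mul, onSimplex_sum_X, one_mul]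
    refine eq_zero_of_onSimplex_eq_zero (mem_harmonic.1 hF).1 ?_
    by_contra h0
    have h1 := totalDegree_of_mem_harmonic hres hF h0
    rw [hφ] at h1
    have h2 := (totalDegree_onSimplex_le G).trans
      ((mem_homogeneousSubmodule _ _).1 hG).totalDegree_le
    omega
  have hinj : Function.Injective
      (LinearMap.mulLeft ℝ (∑ i, X i : MvPolynomial (Fin (d + 1)) ℝ)) := by
    refine fun p q hpq => mul_left_cancel₀ (fun h0 => ?_) hpq
    have := congrArg (onSimplex (d := d)) h0
    rw [onSimplex_sum_X, map_zero] at this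
    exact one_ne_zero this
  have hfS : Module.finrank ℝ S = (d + 1).multichoose n := by
    rw [hS, ← (Submodule.equivMapOfInjective _ hinj _).finrank_eq, finrank_homogeneousSubmodule]
  have : FiniteDimensional ℝ S := by rw [hS]; infer_instance
  have hsum : Module.finrank ℝ ↥(harmonic κ (n + 1) ⊔ S) =
      Module.finrank ℝ (harmonic κ (n + 1)) + (d + 1).multichoose n := by
    have := Submodule.finrank_sup_add_finrank_inf_eq (harmonic κ (n + 1)) S
    rw [hdisj, finrank_bot, add_zero, hfS] at this
    exact this
  -- rank-nullity for the operator from degree `n + 1` to degree `n`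
  have hker : (d + 1).multichoose (n + 1) ≤
      (d + 1).multichoose n + Module.finrank ℝ (harmonic κ (n + 1)) := by
    let L : V →ₗ[ℝ] homogeneousSubmodule (Fin (d + 1)) ℝ n :=
      (lapOp κ).restrict fun F hF => isHomogeneous_lapOp hF
    have h1 := LinearMap.finrank_range_add_finrank_ker L
    have h2 : Module.finrank ℝ (LinearMap.range L) ≤ (d + 1).multichoose n := by
      rw [← finrank_homogeneousSubmodule]
      exact Submodule.finrank_le _
    have h3 : Module.finrank ℝ (LinearMap.ker L) = Module.finrank ℝ (harmonic κ (n + 1)) := by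
      rw [(Submodule.equivMapOfInjective _ V.injective_subtype (LinearMap.ker L)).finrank_eq]
      suffices h : (LinearMap.ker L).map V.subtype = harmonic κ (n + 1) by rw [h]
      ext F
      simp only [Submodule.mem_map, LinearMap.mem_ker, mem_harmonic]
      constructor
      · rintro ⟨⟨F, hF⟩, h, rfl⟩
        exact ⟨hF, congrArg Subtype.val h⟩
      · rintro ⟨hF, h⟩
        exact ⟨⟨F, hF⟩, Subtype.ext h, rfl⟩
    rw [finrank_homogeneousSubmodule] at h1
    omega
  have hle : harmonic κ (n + 1) ⊔ S ≤ V := sup_le hHV hSV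
  have heq : harmonic κ (n + 1) ⊔ S = V := by
    refine Submodule.eq_of_le_of_finrank_le hle ?_
    rw [hsum, finrank_homogeneousSubmodule]
    omega
  refine ⟨heq, ?_⟩
  rw [heq, finrank_homogeneousSubmodule, Nat.multichoose_succ_succ] at hsum
  omega

theorem finrank_map_onSimplex {n : ℕ} {H : Submodule ℝ (MvPolynomial (Fin (d + 1)) ℝ)}
    (hH : H ≤ homogeneousSubmodule (Fin (d + 1)) ℝ n) :
    Module.finrank ℝ (H.map onSimplex.toLinearMap) = Module.finrank ℝ H := by
  have hinj : Function.Injective (onSimplex.toLinearMap.domRestrict H) := by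
    rw [← LinearMap.ker_eq_bot, LinearMap.ker_eq_bot']
    rintro ⟨F, hF⟩ h
    exact Subtype.ext (eq_zero_of_onSimplex_eq_zero (hH hF) h)
  rw [← LinearMap.finrank_range_of_inj hinj, LinearMap.range_domRestrict]

theorem harmonic_zero {σ : Type*} [Fintype σ] (κ : σ → ℝ) : harmonic κ 0 = Submodule.span ℝ {1} := by
  ext F
  rw [mem_harmonic, Submodule.mem_span_singleton]
  constructor
  · rintro ⟨h, -⟩
    refine ⟨coeff 0 F, ?_⟩
    rw [← totalDegree_zero_iff_isHomogeneous, totalDegree_eq_zero_iff_eq_C] at h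
    conv_rhs => rw [h]
    rw [smul_eq_C_mul, mul_one]
  · rintro ⟨r, rfl⟩
    have : (r • (1 : MvPolynomial σ ℝ)).IsHomogeneous 0 := by
      rw [smul_eq_C_mul, mul_one]; exact isHomogeneous_C _ _
    exact ⟨this, lapOp_eq_zero_of_isHomogeneous_zero this⟩

/-! ### Splitting by support -/

section Support

variable {σ : Type*} [DecidableEq σ]

/-- The part of `F` consisting of the monomials in which the variables of `K` that occur are exactly
those of `A`. -/
def supportPart (K A : Finset σ) (F : MvPolynomial σ ℝ) : MvPolynomial σ ℝ :=
  ∑ b ∈ F.support with b.support ∩ K = A, monomial b (coeff b F)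

theorem coeff_supportPart (K A : Finset σ) (F : MvPolynomial σ ℝ) (b : σ →₀ ℕ) :
    coeff b (supportPart K A F) = if b.support ∩ K = A then coeff b F else 0 := by
  simp only [supportPart, coeff_sum, coeff_monomial, Finset.sum_ite_eq', Finset.mem_filter,
    mem_support_iff]
  by_cases h : coeff b F = 0 <;> simp [h]

theorem sum_supportPart (K : Finset σ) (F : MvPolynomial σ ℝ) :
    ∑ A ∈ K.powerset, supportPart K A F = F := by
  ext b
  simp [coeff_sum, coeff_supportPart]

variable [Fintype σ]

/-- Where `κ_i = -1`, the coefficient `b (b + κ_i)` with which `Δ_κ` lowers the exponent `b` of `y_i`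
vanishes for `b = 1`, so no variable of `K` is lost. -/
theorem lapOp_supportPart {κ : σ → ℝ} {K : Finset σ} (hK : ∀ i ∈ K, κ i = -1) (A : Finset σ)
    (F : MvPolynomial σ ℝ) : lapOp κ (supportPart K A F) = supportPart K A (lapOp κ F) := by
  ext b
  simp only [coeff_lapOp, coeff_supportPart, mul_ite, mul_zero]
  have key : ∀ i, (if (b + Finsupp.single i 1).support ∩ K = A then
      (b i + 1 : ℝ) * (b i + 1 + κ i) * coeff (b + Finsupp.single i 1) F else 0) =
      if b.support ∩ K = A then
        (b i + 1 : ℝ) * (b i + 1 + κ i) * coeff (b + Finsupp.single i 1) F else 0 := by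
    intro i
    by_cases h : i ∈ K ∧ b i = 0
    · simp [h.2, hK i h.1]
    · have : (b + Finsupp.single i 1).support ∩ K = b.support ∩ K := by
        ext j
        rcases eq_or_ne j i with rfl | hj
        · simp only [Finset.mem_inter, Finsupp.mem_support_iff, Finsupp.add_apply,
            Finsupp.single_eq_same]
          tauto
        · simp [Finsupp.single_eq_of_ne hj]
      rw [this]
  simp only [key]
  split_ifs <;> simp

/-- The harmonic polynomials all of whose monomials involve, among the variables of `K`, exactly those
of `A`. -/
def harmonicPiece (κ : σ → ℝ) (n : ℕ) (K A : Finset σ) : Submodule ℝ (MvPolynomial σ ℝ) :=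
  harmonic κ n ⊓ restrictSupport ℝ {b | b.support ∩ K = A}

theorem mem_harmonicPiece {κ : σ → ℝ} {n : ℕ} {K A : Finset σ} {F : MvPolynomial σ ℝ} :
    F ∈ harmonicPiece κ n K A ↔
      F ∈ harmonic κ n ∧ ∀ b, coeff b F ≠ 0 → b.support ∩ K = A := by
  rw [harmonicPiece, Submodule.mem_inf, mem_restrictSupport_iff]
  simp [Set.subset_def]

theorem supportPart_mem_harmonicPiece {κ : σ → ℝ} {K : Finset σ} (hK : ∀ i ∈ K, κ i = -1)
    {n : ℕ} {F : MvPolynomial σ ℝ} (hF : F ∈ harmonic κ n) (A : Finset σ) :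
    supportPart K A F ∈ harmonicPiece κ n K A := by
  rw [mem_harmonic] at hF
  refine mem_harmonicPiece.2 ⟨mem_harmonic.2 ⟨?_, ?_⟩, ?_⟩
  · intro b hb
    rw [coeff_supportPart] at hb
    exact hF.1 (fun h => hb (by simp [h]))
  · rw [lapOp_supportPart hK, hF.2]; simp [supportPart]
  · intro b hb
    rw [coeff_supportPart] at hb
    by_contra h
    exact hb (if_neg h)

/-- The predicate `P` selects index sets; the pieces of the others are assumed to be zero. -/
theorem map_harmonic_eq_iSup {κ : Fin (d + 1) → ℝ} {K : Finset (Fin (d + 1))}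
    (hK : ∀ i ∈ K, κ i = -1) (n : ℕ) (P : Finset (Fin (d + 1)) → Prop)
    (hP' : ∀ A, A ⊆ K → ¬ P A → harmonicPiece κ n K A = ⊥) :
    (harmonic κ n).map onSimplex.toLinearMap =
      ⨆ A : {A // P A}, (harmonicPiece κ n K A).map onSimplex.toLinearMap := by
  rw [← Submodule.map_iSup]
  congr 1
  refine le_antisymm (fun F hF => ?_) (iSup_le fun A => inf_le_left)
  rw [← sum_supportPart K F]
  refine Submodule.sum_mem _ fun A hA => ?_
  have hmem := supportPart_mem_harmonicPiece hK hF A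
  by_cases h : P A
  · exact Submodule.mem_iSup_of_mem ⟨A, h⟩ hmem
  · rw [hP' A (Finset.mem_powerset.1 hA) h, Submodule.mem_bot] at hmem
    rw [hmem]; exact zero_mem _

theorem iSupIndep_map_harmonicPiece (κ : Fin (d + 1) → ℝ) (K : Finset (Fin (d + 1)))
    (n : ℕ) (P : Finset (Fin (d + 1)) → Prop) :
    iSupIndep fun A : {A // P A} => (harmonicPiece κ n K A).map onSimplex.toLinearMap := by
  rw [iSupIndep_iff_finsetSum_eq_zero_imp_eq_zero]
  intro s v hv h0 A hA
  choose! F hF hFv using hv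
  have hsum : ∑ A ∈ s, F A = 0 := by
    refine eq_zero_of_onSimplex_eq_zero (N := n)
      (IsHomogeneous.sum _ _ _ fun A hA => (hF A hA).1.1) ?_
    rw [map_sum, ← h0]
    exact Finset.sum_congr rfl fun A hA => hFv A hA
  have hz : F A = 0 := by
    ext b
    by_cases hb : b.support ∩ K = A
    · have h1 := congrArg (coeff b) hsum
      rw [coeff_sum, Finset.sum_eq_single_of_mem A hA] at h1
      · exact h1
      · intro B hB hBA
        by_contra h2
        exact hBA (Subtype.ext (((mem_harmonicPiece.1 (hF B hB)).2 b h2).symm.trans hb))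
    · by_contra h2
      exact hb ((mem_harmonicPiece.1 (hF A hA)).2 b h2)
  rw [← hFv A hA, hz, map_zero]

theorem lapOp_X_mul {κ : σ → ℝ} {i : σ} (hi : κ i = -1) (G : MvPolynomial σ ℝ) :
    lapOp κ (X i * G) = X i * lapOp (Function.update κ i 1) G := by
  rw [lapOp_apply, lapOp_apply, Finset.mul_sum]
  refine Finset.sum_congr rfl fun j _ => ?_
  rcases eq_or_ne j i with rfl | h
  · simp only [pderiv_mul, pderiv_X_self, map_add, hi, Function.update_self]
    simp only [map_neg, map_one]
    simp
    ring
  · simp only [pderiv_mul, pderiv_X_of_ne h.symm, Function.update_of_ne h, zero_mul, zero_add]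
    ring

theorem lapOp_prod_X_mul {κ : σ → ℝ} {A : Finset σ} (hA : ∀ i ∈ A, κ i = -1)
    (G : MvPolynomial σ ℝ) :
    lapOp κ ((∏ i ∈ A, X i) * G) =
      (∏ i ∈ A, X i) * lapOp (fun i => if i ∈ A then 1 else κ i) G := by
  induction A using Finset.induction_on generalizing κ with
  | empty => simp
  | insert i A hi ih =>
    rw [Finset.prod_insert hi, mul_assoc, lapOp_X_mul (hA i (by simp)), ih]
    · rw [mul_assoc]
      congr 4
      ext j
      by_cases hj : j ∈ A
      · simp [hj]
      · rcases eq_or_ne j i with rfl | h <;> simp [*]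
    · intro j hj
      rw [Function.update_of_ne (ne_of_mem_of_not_mem hj hi)]
      exact hA j (Finset.mem_insert_of_mem hj)

theorem lapOp_congr {σ : Type*} [Fintype σ] {κ κ' : σ → ℝ} {G : MvPolynomial σ ℝ}
    (h : ∀ i, κ i ≠ κ' i → ∀ b, coeff b G ≠ 0 → b i = 0) : lapOp κ G = lapOp κ' G := by
  ext b
  rw [coeff_lapOp, coeff_lapOp]
  refine Finset.sum_congr rfl fun i _ => ?_
  by_cases hi : κ i = κ' i
  · rw [hi]
  · have : coeff (b + Finsupp.single i 1) G = 0 := by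
      by_contra h0
      simpa using h i hi _ h0
    rw [this, mul_zero, mul_zero]

/-- The harmonic polynomials of degree `n` in the variables outside `S`. -/
def faceHarmonic {σ : Type*} [Fintype σ] (δ : σ → ℝ) (S : Finset σ) (n : ℕ) : Submodule ℝ (MvPolynomial σ ℝ) :=
  harmonic δ n ⊓ restrictSupport ℝ {b | ∀ i ∈ S, b i = 0}

theorem mem_faceHarmonic {σ : Type*} [Fintype σ] {δ : σ → ℝ} {n : ℕ} {S : Finset σ} {F : MvPolynomial σ ℝ} :
    F ∈ faceHarmonic δ S n ↔
      F ∈ harmonic δ n ∧ ∀ b, coeff b F ≠ 0 → ∀ i ∈ S, b i = 0 := by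
  rw [faceHarmonic, Submodule.mem_inf, mem_restrictSupport_iff]
  simp [Set.subset_def]

/-- The piece of `A` is `∏_{i ∈ A} y_i` times a space of harmonic polynomials with parameters raised
from `-1` to `1` on `A`. The values of `δ` on `K \ A` are irrelevant, since those variables do not
occur in the factor. -/
theorem harmonicPiece_eq_map {κ δ : σ → ℝ} {K A : Finset σ} (hK : ∀ i ∈ K, κ i = -1)
    (hA : A ⊆ K) (hδ : ∀ i ∈ A, δ i = 1) (hδ' : ∀ i ∉ K, δ i = κ i) {n N : ℕ}
    (hn : n = N + A.card) :
    harmonicPiece κ n K A =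
      (faceHarmonic δ (K \ A) N).map (LinearMap.mulLeft ℝ (∏ i ∈ A, X i)) := by
  -- the exponent of the monomial `∏ i ∈ A, X i`
  set a : σ →₀ ℕ := ∑ i ∈ A, Finsupp.single i 1 with ha
  have hai : ∀ i, a i = if i ∈ A then 1 else 0 := by
    intro i; simp [ha, Finsupp.finsetSum_apply, Finsupp.single_apply]
  have hX : (∏ i ∈ A, X i : MvPolynomial σ ℝ) = monomial a 1 := by
    rw [ha, monomial_sum_one]; rfl
  have hdega : a.degree = A.card := by simp [ha, map_sum, Finsupp.degree_single]
  have hlap : ∀ G : MvPolynomial σ ℝ, (∀ b, coeff b G ≠ 0 → ∀ i ∈ K \ A, b i = 0) →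
      lapOp κ ((∏ i ∈ A, X i) * G) = (∏ i ∈ A, X i) * lapOp δ G := by
    intro G hG
    rw [lapOp_prod_X_mul fun i hi => hK i (hA hi)]
    congr 1
    refine lapOp_congr fun i hi b hb => hG b hb i ?_
    by_contra hKA
    apply hi
    by_cases h : i ∈ A
    · simp [h, hδ i h]
    · have : i ∉ K := fun h' => hKA (Finset.mem_sdiff.2 ⟨h', h⟩)
      simp [h, hδ' i this]
  ext F
  rw [Submodule.mem_map]
  constructor
  · intro hF
    rw [mem_harmonicPiece, mem_harmonic] at hF
    obtain ⟨⟨hFh, hFl⟩, hFs⟩ := hF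
    have hdvd : monomial a 1 ∣ F := by
      rw [monomial_one_dvd_iff_modMonomial_eq_zero]
      ext b
      by_cases hab : a ≤ b
      · rw [coeff_modMonomial_of_le _ hab, coeff_zero]
      · rw [coeff_modMonomial_of_not_le _ hab, coeff_zero]
        by_contra h0
        refine hab fun i => ?_
        rw [hai]
        split_ifs with hi
        · rw [← hFs b h0] at hi
          simp at hi
          omega
        · exact Nat.zero_le _
    obtain ⟨G, rfl⟩ := hdvd
    have hc : ∀ b, coeff b G = coeff (a + b) (monomial a 1 * G) := by
      intro b; rw [coeff_monomial_mul, one_mul]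
    have hGS : ∀ b, coeff b G ≠ 0 → ∀ i ∈ K \ A, b i = 0 := by
      intro b hb i hi
      rw [hc] at hb
      have h1 := hFs _ hb
      by_contra h0
      rw [Finset.mem_sdiff] at hi
      apply hi.2
      rw [← h1]
      simp [hi.1, h0]
    refine ⟨G, mem_faceHarmonic.2 ⟨mem_harmonic.2 ⟨?_, ?_⟩, hGS⟩, by simp [hX]⟩
    · intro b hb
      rw [hc] at hb
      have := hFh hb
      change Finsupp.weight (fun _ => 1) _ = _ at this ⊢
      rw [← Finsupp.degree_eq_weight_one] at this ⊢
      rw [map_add] at this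
      omega
    · rw [← hX, hlap G hGS] at hFl
      refine (mul_eq_zero.1 hFl).resolve_left ?_
      rw [hX]
      simp
  · rintro ⟨G, hG, rfl⟩
    rw [mem_faceHarmonic, mem_harmonic] at hG
    obtain ⟨⟨hGh, hGl⟩, hGS⟩ := hG
    rw [LinearMap.mulLeft_apply]
    refine mem_harmonicPiece.2 ⟨mem_harmonic.2 ⟨?_, ?_⟩, ?_⟩
    · rw [hX, hn, add_comm]
      exact (isHomogeneous_monomial _ hdega).mul hGh
    · rw [hlap G hGS, hGl, mul_zero]
    · intro b hb
      rw [hX, coeff_monomial_mul'] at hb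
      have hab : a ≤ b := by by_contra h; simp [h] at hb
      rw [if_pos hab, one_mul] at hb
      ext i
      rw [Finset.mem_inter, Finsupp.mem_support_iff]
      have h1 := hab i
      rw [hai] at h1
      constructor
      · rintro ⟨hbi, hi⟩
        by_contra hiA
        have h2 := hGS _ hb i (Finset.mem_sdiff.2 ⟨hi, hiA⟩)
        rw [Finsupp.tsub_apply, hai, if_neg hiA] at h2
        omega
      · intro hi
        rw [if_pos hi] at h1
        exact ⟨by omega, hA hi⟩

theorem harmonicPiece_eq_bot_of_lt {κ : σ → ℝ} {K A : Finset σ} {n : ℕ} (h : n < A.card) :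
    harmonicPiece κ n K A = ⊥ := by
  rw [eq_bot_iff]
  intro F hF
  rw [mem_harmonicPiece, mem_harmonic] at hF
  ext b
  rw [coeff_zero]
  by_contra hb
  have h1 : A.card ≤ b.support.card := by
    rw [← hF.2 b hb]; exact Finset.card_le_card Finset.inter_subset_left
  have h2 : b.support.card ≤ b.degree := by
    rw [Finset.card_eq_sum_ones]
    exact Finset.sum_le_sum fun i hi => Nat.one_le_iff_ne_zero.2 (by simpa using hi)
  have h3 : b.degree = n := by
    by_contra h3
    exact hb (hF.1.1.coeff_eq_zero h3)
  omega

/-- If all parameters are `-1`, a constant and a power `y_i ^ n` are not harmonic of degree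
`n ≥ 2`. -/
theorem harmonicPiece_univ_eq_bot {κ : σ → ℝ} (hκ : ∀ i, κ i = -1) {A : Finset σ} {n : ℕ}
    (hn : 2 ≤ n) (hA : A.card < 2) : harmonicPiece κ n Finset.univ A = ⊥ := by
  rw [eq_bot_iff]
  intro F hF
  rw [mem_harmonicPiece, mem_harmonic] at hF
  ext b
  rw [coeff_zero]
  by_contra hb
  have hs := hF.2 b hb
  rw [Finset.inter_univ] at hs
  have hdeg : b.degree = n := by
    by_contra h3
    exact hb (hF.1.1.coeff_eq_zero h3)
  rcases Nat.lt_succ_iff_lt_or_eq.1 hA with h | h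
  · have : A = ∅ := by rw [← Finset.card_eq_zero]; omega
    rw [this, Finsupp.support_eq_empty] at hs
    rw [hs, map_zero] at hdeg
    omega
  · obtain ⟨i, rfl⟩ := Finset.card_eq_one.1 h
    have hbi : b = Finsupp.single i n := by
      ext j
      rcases eq_or_ne j i with rfl | hj
      · rw [Finsupp.single_eq_same, ← hdeg, Finsupp.degree_apply, hs, Finset.sum_singleton]
      · rw [Finsupp.single_eq_of_ne hj]
        exact Finsupp.notMem_support_iff.1 (by simp [hs, hj])
    have h0 := congrArg (coeff (Finsupp.single i (n - 1))) hF.1.2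
    rw [coeff_lapOp, coeff_zero, Finset.sum_eq_single i] at h0
    · rw [← Finsupp.single_add, Nat.sub_add_cancel (by omega), ← hbi, hκ, Finsupp.single_eq_same]
        at h0
      have h1 : (0 : ℝ) < ((n - 1 : ℕ) : ℝ) := by exact_mod_cast (by omega : 0 < n - 1)
      rcases mul_eq_zero.1 h0 with h0 | h0
      · have : ((n - 1 : ℕ) : ℝ) + 1 + -1 ≠ 0 := by linarith
        rcases mul_eq_zero.1 h0 with h0 | h0
        · linarith
        · exact this h0
      · exact hb h0
    · intro j _ hj
      have : coeff (Finsupp.single i (n - 1) + Finsupp.single j 1) F = 0 := by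
        by_contra h2
        have h3 := hF.2 _ h2
        rw [Finset.inter_univ] at h3
        have : j ∈ ({i} : Finset σ) := by rw [← h3]; simp
        exact hj (by simpa using this)
      rw [this, mul_zero]
    · simp

end Support

/-! ### Edge derivatives and the Rodrigues formula -/

theorem continuous_bary_apply (i : Fin (d + 1)) : Continuous fun x : Fin d → ℝ => bary x i := by
  simp only [← eval_baryPoly]
  exact MvPolynomial.continuous_eval _

theorem isOpen_openSimplex (d : ℕ) : IsOpen (openSimplex d) := by
  rw [openSimplex, Set.ofPred_forall]
  exact isOpen_iInter_of_finite fun i => isOpen_lt continuous_const (continuous_bary_apply i)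

theorem pi_Ioo_subset_openSimplex (d : ℕ) :
    Set.pi Set.univ (fun _ : Fin d => Set.Ioo (0 : ℝ) (1 / (d + 1))) ⊆ openSimplex d := by
  intro x hx i
  refine Fin.lastCases ?_ (fun j => ?_) i
  · have h1 : ∑ i, x i ≤ ∑ _i : Fin d, (1 / (d + 1) : ℝ) :=
      Finset.sum_le_sum fun i _ => (hx i trivial).2.le
    have h2 : ∑ _i : Fin d, (1 / (d + 1) : ℝ) < 1 := by
      rw [Finset.sum_const, Finset.card_fin, nsmul_eq_mul, mul_one_div, div_lt_one (by positivity)]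
      linarith
    simp only [bary, Fin.snoc_last]
    linarith
  · simpa [bary] using (hx j trivial).1

theorem eq_of_eval_eq_on_openSimplex {p q : MvPolynomial (Fin d) ℝ}
    (h : ∀ x ∈ openSimplex d, eval x p = eval x q) : p = q :=
  funext_set (fun _ : Fin d => Set.Ioo (0 : ℝ) (1 / (d + 1)))
    (fun _ => Set.Ioo_infinite (by positivity)) fun x hx => h x (pi_Ioo_subset_openSimplex d hx)

section EdgeOp

variable {σ : Type*}

/-- The operator `F ↦ W_δ⁻¹ (∂_i - ∂_m) (W_δ y_i y_m F)`, where `W_δ = ∏ y_j^{δ_j}`. -/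
def edgeOp (δ : σ → ℝ) (i m : σ) : MvPolynomial σ ℝ →ₗ[ℝ] MvPolynomial σ ℝ :=
  LinearMap.mulLeft ℝ (X i * X m) ∘ₗ ((pderiv i).toLinearMap - (pderiv m).toLinearMap) +
    LinearMap.mulLeft ℝ (C (δ i + 1) * X m - C (δ m + 1) * X i)

theorem edgeOp_apply (δ : σ → ℝ) (i m : σ) (F : MvPolynomial σ ℝ) :
    edgeOp δ i m F = X i * X m * (pderiv i F - pderiv m F) +
      (C (δ i + 1) * X m - C (δ m + 1) * X i) * F := by
  simp [edgeOp, mul_assoc]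

theorem isHomogeneous_edgeOp (δ : σ → ℝ) (i m : σ) {F : MvPolynomial σ ℝ} {n : ℕ}
    (hF : F.IsHomogeneous n) : (edgeOp δ i m F).IsHomogeneous (n + 1) := by
  rw [edgeOp_apply]
  refine IsHomogeneous.add ?_ ?_
  · rcases n with _ | n
    · rw [← totalDegree_zero_iff_isHomogeneous, totalDegree_eq_zero_iff_eq_C] at hF
      rw [hF]
      simp [isHomogeneous_zero]
    · have h := ((isHomogeneous_X ℝ i).mul (isHomogeneous_X ℝ m)).mul
        ((hF.pderiv (i := i)).sub (hF.pderiv (i := m)))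
      rwa [Nat.add_sub_cancel, show 1 + 1 + n = n + 1 + 1 by ring] at h
  · rw [add_comm n 1]
    exact (((isHomogeneous_X ℝ m).C_mul _).sub ((isHomogeneous_X ℝ i).C_mul _)).mul hF

theorem X_dvd_edgeOp_sub (δ : σ → ℝ) (i m : σ) (F : MvPolynomial σ ℝ) :
    X m ∣ edgeOp δ i m F - C (-(δ m + 1)) * X i * F := by
  refine ⟨X i * (pderiv i F - pderiv m F) + C (δ i + 1) * F, ?_⟩
  rw [edgeOp_apply, C_neg]
  ring

theorem edgeOp_intertwine_pair (δ : σ → ℝ) {i m : σ} (him : i ≠ m) (F : MvPolynomial σ ℝ) :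
    X i * pderiv i (pderiv i (edgeOp δ i m F)) + C (δ i + 1) * pderiv i (edgeOp δ i m F) +
    (X m * pderiv m (pderiv m (edgeOp δ i m F)) + C (δ m + 1) * pderiv m (edgeOp δ i m F)) =
   edgeOp δ i m (X i * pderiv i (pderiv i F) + C (δ i + 1 + 1) * pderiv i F) +
   edgeOp δ i m (X m * pderiv m (pderiv m F) + C (δ m + 1 + 1) * pderiv m F) := by
  simp only [edgeOp_apply, map_add, map_sub, pderiv_mul, pderiv_X_self, pderiv_C,
    pderiv_X_of_ne him, pderiv_X_of_ne him.symm, pderiv_one, pderiv_comm m i, map_zero, map_one]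
  generalize pderiv i (pderiv i (pderiv i F)) = Fiii
  generalize pderiv i (pderiv i (pderiv m F)) = Fiim
  generalize pderiv i (pderiv m (pderiv m F)) = Fimm
  generalize pderiv m (pderiv m (pderiv m F)) = Fmmm
  generalize pderiv i (pderiv i F) = Fii
  generalize pderiv i (pderiv m F) = Fim
  generalize pderiv m (pderiv m F) = Fmm
  generalize pderiv i F = Fi
  generalize pderiv m F = Fm
  generalize (C (δ i) : MvPolynomial σ ℝ) = a
  generalize (C (δ m) : MvPolynomial σ ℝ) = b
  generalize (X i : MvPolynomial σ ℝ) = x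
  generalize (X m : MvPolynomial σ ℝ) = y
  ring

theorem edgeOp_intertwine_of_ne (δ : σ → ℝ) {i m j : σ} (hji : j ≠ i) (hjm : j ≠ m) (a : ℝ)
    (F : MvPolynomial σ ℝ) :
    X j * pderiv j (pderiv j (edgeOp δ i m F)) + C a * pderiv j (edgeOp δ i m F) =
   edgeOp δ i m (X j * pderiv j (pderiv j F) + C a * pderiv j F) := by
  simp only [edgeOp_apply, map_add, map_sub, pderiv_mul, pderiv_C, pderiv_one,
    pderiv_X_of_ne hjm, pderiv_X_of_ne hji, pderiv_X_of_ne hjm.symm, pderiv_X_of_ne hji.symm,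
    pderiv_comm j i, pderiv_comm j m, map_zero, map_one]
  ring

variable [Fintype σ]

/-- `edgeOp δ i m` maps harmonic polynomials with parameters `δ + e_i + e_m` to harmonic polynomials
with parameters `δ`. The part of `Δ` in `y_i` and `y_m` and its part in each other variable are
intertwined separately. -/
theorem lapOp_edgeOp [DecidableEq σ] (δ : σ → ℝ) {i m : σ} (him : i ≠ m) (F : MvPolynomial σ ℝ) :
    lapOp δ (edgeOp δ i m F) =
      edgeOp δ i m (lapOp (δ + (Pi.single i 1 + Pi.single m 1)) F) := by
  have hm : m ∈ Finset.univ.erase i := Finset.mem_erase.2 ⟨him.symm, Finset.mem_univ m⟩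
  have hsplit : ∀ f : σ → MvPolynomial σ ℝ,
      ∑ j, f j = f i + f m + ∑ j ∈ (Finset.univ.erase i).erase m, f j := by
    intro f
    rw [add_assoc, Finset.add_sum_erase _ _ hm, Finset.add_sum_erase _ _ (Finset.mem_univ i)]
  rw [lapOp_apply, lapOp_apply, hsplit, hsplit, (edgeOp δ i m).map_add, (edgeOp δ i m).map_add, map_sum]
  have hi' : (δ + (Pi.single i 1 + Pi.single m 1) : σ → ℝ) i + 1 = δ i + 1 + 1 := by simp [him]
  have hm' : (δ + (Pi.single i 1 + Pi.single m 1) : σ → ℝ) m + 1 = δ m + 1 + 1 := by simp [him.symm]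
  refine congrArg₂ (· + ·) ?_ ?_
  · rw [edgeOp_intertwine_pair δ him, hi', hm', (edgeOp δ i m).map_add]
  · refine Finset.sum_congr rfl fun j hj => ?_
    have hjm : j ≠ m := Finset.ne_of_mem_erase hj
    have hji : j ≠ i := Finset.ne_of_mem_erase (Finset.mem_of_mem_erase hj)
    rw [edgeOp_intertwine_of_ne δ hji hjm]
    have hj' : (δ + (Pi.single i 1 + Pi.single m 1) : σ → ℝ) j + 1 = δ j + 1 := by simp [hji, hjm]
    rw [hj']

theorem edgeOp_mem_faceHarmonic [DecidableEq σ] {δ : σ → ℝ} {i m : σ} (him : i ≠ m) {S : Finset σ}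
    (hi : i ∉ S) (hm : m ∉ S) {n : ℕ} {F : MvPolynomial σ ℝ}
    (hF : F ∈ faceHarmonic (δ + (Pi.single i 1 + Pi.single m 1)) S n) :
    edgeOp δ i m F ∈ faceHarmonic δ S (n + 1) := by
  rw [faceHarmonic, Submodule.mem_inf, mem_harmonic] at hF ⊢
  refine ⟨⟨isHomogeneous_edgeOp _ _ _ hF.1.1, by rw [lapOp_edgeOp _ him, hF.1.2, map_zero]⟩, ?_⟩
  have hX : ∀ j ∉ S, ∀ G ∈ restrictSupport ℝ {b : σ →₀ ℕ | ∀ i ∈ S, b i = 0},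
      X j * G ∈ restrictSupport ℝ {b : σ →₀ ℕ | ∀ i ∈ S, b i = 0} := by
    intro j hj G hG b hb l hl
    have hb' : b ∈ (X j * G).support := hb
    rw [support_X_mul, Finset.mem_map] at hb'
    obtain ⟨b', hb', rfl⟩ := hb'
    have := hG hb' l hl
    have hlj : l ≠ j := by rintro rfl; exact hj hl
    simp [this, Finsupp.single_eq_of_ne hlj]
  have hp : ∀ j ∉ S, ∀ G ∈ restrictSupport ℝ {b : σ →₀ ℕ | ∀ i ∈ S, b i = 0},
      pderiv j G ∈ restrictSupport ℝ {b : σ →₀ ℕ | ∀ i ∈ S, b i = 0} := by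
    intro j hj G hG b hb l hl
    have hb' : coeff b (pderiv j G) ≠ 0 := mem_support_iff.1 hb
    rw [coeff_pderiv] at hb'
    have := hG (mem_support_iff.2 (left_ne_zero_of_mul hb')) l hl
    simp at this
    exact this.1
  have : edgeOp δ i m F = X i * (X m * (pderiv i F - pderiv m F)) + ((δ i + 1) • (X m * F) -
      (δ m + 1) • (X i * F)) := by
    rw [edgeOp_apply, smul_eq_C_mul, smul_eq_C_mul]; ring
  rw [this]
  exact add_mem (hX i hi _ (hX m hm _ (sub_mem (hp i hi _ hF.2) (hp m hm _ hF.2))))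
    (sub_mem (Submodule.smul_mem _ _ (hX m hm _ hF.2)) (Submodule.smul_mem _ _ (hX i hi _ hF.2)))

theorem X_dvd_iff_coeff {σ : Type*} {m : σ} {F : MvPolynomial σ ℝ} :
    X m ∣ F ↔ ∀ b, b m = 0 → coeff b F = 0 := by
  classical
  rw [X_dvd_iff_modMonomial_eq_zero]
  constructor
  · intro h b hb
    rw [← coeff_modMonomial_of_not_le (s := Finsupp.single m 1), h, coeff_zero]
    simp [hb]
  · intro h
    ext b
    by_cases hb : Finsupp.single m 1 ≤ b
    · rw [coeff_modMonomial_of_le _ hb, coeff_zero]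
    · rw [coeff_modMonomial_of_not_le _ hb, coeff_zero]
      exact h b (by simpa using hb)

/-- If `δ_m > -1`, a harmonic polynomial is determined by its restriction to the facet `y_m = 0`:
comparing coefficients in `Δ_δ F = 0` expresses those with exponent `r + 1` of `y_m` through those
with exponent `r`, with the nonzero factor `(r + 1) (r + 1 + δ_m)`. -/
theorem eq_zero_of_mem_harmonic_of_X_dvd {δ : σ → ℝ} {m : σ} (hm : -1 < δ m) {n : ℕ}
    {F : MvPolynomial σ ℝ} (hF : F ∈ harmonic δ n) (h : X m ∣ F) : F = 0 := by
  classical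
  have key : ∀ r : ℕ, ∀ b : σ →₀ ℕ, b m = r → coeff b F = 0 := by
    intro r
    induction r with
    | zero => exact X_dvd_iff_coeff.1 h
    | succ r ih =>
      intro b hb
      set b' := b - Finsupp.single m 1
      have hbb : b = b' + Finsupp.single m 1 := by
        rw [tsub_add_cancel_of_le]; simp [hb]
      have hb' : b' m = r := by simp [b', hb]
      have h0 := congrArg (coeff b') (mem_harmonic.1 hF).2
      rw [coeff_lapOp, coeff_zero, Finset.sum_eq_single m] at h0
      · rw [← hbb, hb'] at h0
        have h1 : ((r : ℝ) + 1) * (r + 1 + δ m) ≠ 0 := by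
          have : (0 : ℝ) ≤ r := Nat.cast_nonneg r
          exact mul_ne_zero (by linarith) (by linarith)
        exact (mul_eq_zero.1 h0).resolve_left h1
      · intro j _ hj
        rw [ih _ (by simp [hb', Finsupp.single_eq_of_ne hj.symm]), mul_zero]
      · simp
  ext b
  exact key _ b rfl

end EdgeOp

theorem bary_add_smul (x : Fin d → ℝ) (i m : Fin (d + 1)) (t : ℝ) :
    bary (x + t • (vertex i - vertex m)) = bary x + t • (Pi.single i 1 - Pi.single m 1) := by
  have hs : ∀ i : Fin (d + 1),
      -∑ j, vertex i j = (Pi.single i 1 : Fin (d + 1) → ℝ) (Fin.last d) - 1 := by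
    intro i
    refine Fin.lastCases ?_ (fun i => ?_) i
    · simp [vertex]
    · simp [vertex, Pi.single_apply, (Fin.castSucc_ne_last i).symm]
  have hv : ∀ (i : Fin (d + 1)) (j : Fin d), vertex i j =
      (Pi.single i 1 : Fin (d + 1) → ℝ) j.castSucc := by
    intro i j
    refine Fin.lastCases ?_ (fun i => ?_) i
    · simp [vertex]
    · simp [vertex, Pi.single_apply]
  ext j
  refine Fin.lastCases ?_ (fun j => ?_) j
  · have h1 := hs i
    have h2 := hs m
    simp only [bary, Fin.snoc_last, Pi.add_apply, Pi.smul_apply, Pi.sub_apply, smul_eq_mul,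
      Finset.sum_add_distrib, ← Finset.mul_sum, Finset.sum_sub_distrib]
    linear_combination t * h1 - t * h2
  · simp [bary, hv]

theorem hasDerivAt_eval_line (y v : Fin (d + 1) → ℝ) (F : MvPolynomial (Fin (d + 1)) ℝ) :
    HasDerivAt (fun t : ℝ => eval (y + t • v) F) (∑ j, v j * eval y (pderiv j F)) 0 := by
  induction F using MvPolynomial.induction_on with
  | C a => simpa using hasDerivAt_const (0 : ℝ) a
  | add p q hp hq =>
    simp only [map_add, mul_add, Finset.sum_add_distrib]
    exact hp.fun_add hq
  | mul_X p l h =>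
    have hl : HasDerivAt (fun t : ℝ => y l + t * v l) (v l) 0 := by
      simpa using ((hasDerivAt_id (0 : ℝ)).mul_const (v l)).const_add (y l)
    have := h.fun_mul hl
    have hfun : (fun t : ℝ => eval (y + t • v) (p * X l)) =
        fun t => eval (y + t • v) p * (y l + t * v l) := by
      ext t; simp
    rw [hfun]
    refine this.congr_deriv ?_
    simp only [pderiv_mul, pderiv_X, Pi.single_apply, mul_add, Finset.sum_add_distrib,
      Finset.sum_mul, map_add, map_mul, eval_X, zero_smul, add_zero, zero_mul, apply_ite (eval y),
      map_zero, mul_ite, mul_one, mul_zero, Finset.sum_ite_eq, Finset.mem_univ, if_true,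
      mul_assoc]
    ring

/-- The derivative of a weight times a polynomial along an edge of the simplex. -/
theorem hasLineDerivAt_weight_mul (δ : Fin (d + 1) → ℝ) {i m : Fin (d + 1)} (him : i ≠ m)
    (F : MvPolynomial (Fin (d + 1)) ℝ) {x : Fin d → ℝ} (hx : x ∈ openSimplex d) :
    HasLineDerivAt ℝ (fun x => weight (δ + (Pi.single i 1 + Pi.single m 1)) x * eval (bary x) F)
      (weight δ x * eval (bary x) (edgeOp δ i m F)) x (vertex i - vertex m) := by
  rw [HasLineDerivAt]
  set y := bary x with hy
  have hprod : ∀ f : Fin (d + 1) → ℝ,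
      ∏ j, f j = f i * (f m * ∏ j ∈ (Finset.univ.erase i).erase m, f j) := by
    intro f
    rw [Finset.mul_prod_erase _ _ (Finset.mem_erase.2 ⟨him.symm, Finset.mem_univ m⟩),
      Finset.mul_prod_erase _ _ (Finset.mem_univ i)]
  set c := ∏ j ∈ (Finset.univ.erase i).erase m, y j ^ δ j with hc
  have hfun : (fun t : ℝ => weight (δ + (Pi.single i 1 + Pi.single m 1))
        (x + t • (vertex i - vertex m)) * eval (bary (x + t • (vertex i - vertex m))) F) =
      fun t : ℝ => ((y i + t) ^ (δ i + 1) * ((y m - t) ^ (δ m + 1) * c)) *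
        eval (y + t • (Pi.single i 1 - Pi.single m 1)) F := by
    ext t
    rw [weight, bary_add_smul, hprod]
    congr 2
    · simp [him, hy]
    · congr 1
      · simp [him.symm, hy, sub_eq_add_neg]
      · rw [hc]
        refine Finset.prod_congr rfl fun j hj => ?_
        have hjm : j ≠ m := Finset.ne_of_mem_erase hj
        have hji : j ≠ i := Finset.ne_of_mem_erase (Finset.mem_of_mem_erase hj)
        simp [hjm, hji, hy]
  rw [hfun]
  have hyi : 0 < y i := hx i
  have hym : 0 < y m := hx m
  have h1 : HasDerivAt (fun t : ℝ => (y i + t) ^ (δ i + 1)) ((δ i + 1) * y i ^ δ i) 0 := by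
    have := ((hasDerivAt_id (0 : ℝ)).const_add (y i)).rpow_const (p := δ i + 1)
      (Or.inl (by simpa using hyi.ne'))
    simpa using this
  have h2 : HasDerivAt (fun t : ℝ => (y m - t) ^ (δ m + 1)) (-((δ m + 1) * y m ^ δ m)) 0 := by
    have := ((hasDerivAt_id (0 : ℝ)).const_sub (y m)).rpow_const (p := δ m + 1)
      (Or.inl (by simpa using hym.ne'))
    exact this.congr_deriv (by simp; ring)
  have h3 := (h1.fun_mul (h2.mul_const c)).fun_mul
    (hasDerivAt_eval_line y (Pi.single i 1 - Pi.single m 1) F)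
  refine h3.congr_deriv ?_
  have hw : weight δ x = y i ^ δ i * (y m ^ δ m * c) := by rw [weight, hprod]
  have hs : ∑ j, (Pi.single i 1 - Pi.single m 1 : Fin (d + 1) → ℝ) j * eval y (pderiv j F) =
      eval y (pderiv i F) - eval y (pderiv m F) := by
    simp [sub_mul, Finset.sum_sub_distrib, Pi.single_apply]
  simp only [hw, hs, edgeOp_apply, map_add, map_sub, map_mul, eval_X, eval_C, zero_smul, add_zero,
    sub_zero, Real.rpow_add_one hyi.ne', Real.rpow_add_one hym.ne']
  ring

/-- On the open simplex, `f` is the weight `W_δ` times the polynomial `F` in the coordinates. -/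
def IsWeightMul (δ : Fin (d + 1) → ℝ) (f : (Fin d → ℝ) → ℝ) (F : MvPolynomial (Fin (d + 1)) ℝ) :
    Prop :=
  ∀ x ∈ openSimplex d, f x = weight δ x * eval (bary x) F

theorem IsWeightMul.dirDeriv {δ : Fin (d + 1) → ℝ} {i m : Fin (d + 1)} (him : i ≠ m)
    {f : (Fin d → ℝ) → ℝ} {F : MvPolynomial (Fin (d + 1)) ℝ}
    (h : IsWeightMul (δ + (Pi.single i 1 + Pi.single m 1)) f F) :
    IsWeightMul δ (dirDeriv (vertex i - vertex m) f) (edgeOp δ i m F) := by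
  intro x hx
  have hev : f =ᶠ[nhds x] fun x => weight (δ + (Pi.single i 1 + Pi.single m 1)) x *
      eval (bary x) F :=
    Filter.eventuallyEq_of_mem ((isOpen_openSimplex d).mem_nhds hx) h
  rw [SimplexPoly.dirDeriv, hev.lineDeriv_eq]
  exact (hasLineDerivAt_weight_mul δ him F hx).lineDeriv

/-- The `j`-fold derivative along the edge from `m` to `i` of a weight times a harmonic polynomial `F`
is a weight times a harmonic polynomial, congruent to a nonzero multiple of `y_i ^ j F` modulo
`y_m`. -/
theorem exists_isWeightMul_iterate {δ : Fin (d + 1) → ℝ} {i m : Fin (d + 1)} (him : i ≠ m)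
    {S : Finset (Fin (d + 1))} (hi : i ∉ S) (hm : m ∉ S) (hδ : -1 < δ m) (j : ℕ)
    {f : (Fin d → ℝ) → ℝ} {F : MvPolynomial (Fin (d + 1)) ℝ} {n : ℕ}
    (hf : IsWeightMul (δ + j • (Pi.single i 1 + Pi.single m 1)) f F)
    (hF : F ∈ faceHarmonic (δ + j • (Pi.single i 1 + Pi.single m 1)) S n) :
    ∃ (G : MvPolynomial (Fin (d + 1)) ℝ) (c : ℝ), c ≠ 0 ∧ G ∈ faceHarmonic δ S (n + j) ∧
      IsWeightMul δ ((dirDeriv (vertex i - vertex m))^[j] f) G ∧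
      X m ∣ G - C c * X i ^ j * F := by
  induction j generalizing f F n with
  | zero => exact ⟨F, 1, one_ne_zero, by simpa using hF, by simpa using hf, by simp⟩
  | succ j ih =>
    rw [succ_nsmul, ← add_assoc] at hf hF
    obtain ⟨G, c, hc, hG, hGf, q, hq⟩ := ih (hf.dirDeriv him) (edgeOp_mem_faceHarmonic him hi hm hF)
    set δ' := δ + j • (Pi.single i 1 + Pi.single m 1) with hδ'
    obtain ⟨q', hq'⟩ := X_dvd_edgeOp_sub δ' i m F
    have hpos : 0 < δ' m + 1 := by
      have : (0 : ℝ) ≤ j := Nat.cast_nonneg j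
      simp [hδ', him.symm]
      linarith
    refine ⟨G, c * -(δ' m + 1), mul_ne_zero hc (by linarith), ?_, ?_, q + C c * X i ^ j * q', ?_⟩
    · rwa [show n + (j + 1) = n + 1 + j by ring]
    · rwa [Function.iterate_succ_apply]
    · rw [C_mul]
      linear_combination hq + C c * X i ^ j * hq'

theorem exists_isWeightMul_foldr {m : Fin (d + 1)} {S : Finset (Fin (d + 1))} (hm : m ∉ S)
    (ν : Fin (d + 1) → ℕ) (l : List (Fin (d + 1))) (hl : ∀ i ∈ l, ν i ≠ 0 → i ≠ m ∧ i ∉ S)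
    {δ : Fin (d + 1) → ℝ} (hδ : -1 < δ m)
    {f : (Fin d → ℝ) → ℝ} {F : MvPolynomial (Fin (d + 1)) ℝ} {n : ℕ}
    (hf : IsWeightMul (δ + (l.map fun i => ν i • (Pi.single i 1 + Pi.single m 1)).sum) f F)
    (hF : F ∈ faceHarmonic (δ + (l.map fun i => ν i • (Pi.single i 1 + Pi.single m 1)).sum) S n) :
    ∃ (G : MvPolynomial (Fin (d + 1)) ℝ) (c : ℝ), c ≠ 0 ∧
      G ∈ faceHarmonic δ S (n + (l.map ν).sum) ∧
      IsWeightMul δ (l.foldr (fun i g => (dirDeriv (vertex i - vertex m))^[ν i] g) f) G ∧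
      X m ∣ G - C c * (l.map fun i => X i ^ ν i).prod * F := by
  induction l generalizing δ with
  | nil => exact ⟨F, 1, one_ne_zero, by simpa using hF, by simpa using hf, by simp⟩
  | cons i l ih =>
    rw [List.map_cons, List.sum_cons, ← add_assoc] at hf hF
    have hδ' : -1 < (δ + ν i • (Pi.single i 1 + Pi.single m 1) : Fin (d + 1) → ℝ) m := by
      have h1 : (0 : ℝ) ≤ ν i := Nat.cast_nonneg _
      have h2 : (0 : ℝ) ≤ (Pi.single i 1 : Fin (d + 1) → ℝ) m := by
        rw [Pi.single_apply]; split_ifs <;> norm_num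
      rw [Pi.add_apply, Pi.smul_apply, Pi.add_apply, Pi.single_eq_same, nsmul_eq_mul]
      have := mul_nonneg h1 (add_nonneg h2 zero_le_one)
      linarith
    obtain ⟨G, c, hc, hG, hGf, q, hq⟩ := ih (fun j hj => hl j (List.mem_cons_of_mem _ hj)) hδ' hf hF
    simp only [List.foldr_cons, List.map_cons, List.sum_cons, List.prod_cons]
    rcases Nat.eq_zero_or_pos (ν i) with h0 | hpos
    · rw [h0, zero_nsmul, add_zero] at hG hGf
      exact ⟨G, c, hc, by simpa [h0] using hG, by simpa [h0] using hGf, q, by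
        rw [h0, pow_zero, one_mul, hq]⟩
    · obtain ⟨him, hi⟩ := hl i List.mem_cons_self hpos.ne'
      obtain ⟨G', c', hc', hG', hGf', q', hq'⟩ :=
        exists_isWeightMul_iterate him hi hm hδ (ν i) hGf hG
      refine ⟨G', c' * c, mul_ne_zero hc' hc, ?_, hGf', q' + C c' * X i ^ ν i * q, ?_⟩
      · rwa [add_comm (ν i), ← add_assoc]
      · rw [C_mul]
        linear_combination hq' + C c' * X i ^ ν i * hq

theorem weight_neg_mul_weight (δ : Fin (d + 1) → ℝ) {x : Fin d → ℝ} (hx : x ∈ openSimplex d) :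
    weight (fun i => -δ i) x * weight δ x = 1 := by
  rw [weight, weight, ← Finset.prod_mul_distrib]
  refine Finset.prod_eq_one fun i _ => ?_
  rw [← Real.rpow_add (hx i), neg_add_cancel, Real.rpow_zero]

/-- The Rodrigues polynomial of `ν` is the restriction of a harmonic polynomial that is congruent to a
nonzero multiple of `y^ν` modulo `y_m`. -/
theorem exists_eval_eq_rodrigues {δ : Fin (d + 1) → ℝ} {m : Fin (d + 1)} {S : Finset (Fin (d + 1))}
    (hm : m ∉ S) (hδ : -1 < δ m) {ν : Fin (d + 1) → ℕ} (hνm : ν m = 0) (hνS : ∀ i ∈ S, ν i = 0) :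
    ∃ (G : MvPolynomial (Fin (d + 1)) ℝ) (c : ℝ), c ≠ 0 ∧ G ∈ faceHarmonic δ S (∑ i, ν i) ∧
      (∀ x ∈ openSimplex d, eval x (onSimplex G) = rodrigues δ m ν x) ∧
      X m ∣ G - C c * ∏ i, X i ^ ν i := by
  have hexp : (fun i => δ i + (if i = m then ((∑ l, ν l : ℕ) : ℝ) else (ν i : ℝ))) =
      δ + ((List.finRange (d + 1)).map fun i => ν i • (Pi.single i 1 + Pi.single m 1)).sum := by
    rw [← Fin.sum_univ_def]
    ext j
    simp only [Pi.add_apply, Finset.sum_apply, Pi.smul_apply, smul_add, Finset.sum_add_distrib]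
    simp only [nsmul_eq_mul, Pi.single_apply, mul_ite, mul_one, mul_zero, Finset.sum_ite_eq,
      Finset.mem_univ, if_true]
    split_ifs with h
    · rw [h, hνm]; simp
    · simp
  have h1 : (1 : MvPolynomial (Fin (d + 1)) ℝ) ∈ faceHarmonic
      (δ + ((List.finRange (d + 1)).map fun i => ν i • (Pi.single i 1 + Pi.single m 1)).sum) S 0 := by
    refine mem_faceHarmonic.2 ⟨?_, fun b hb i _ => ?_⟩
    · rw [harmonic_zero]; exact Submodule.mem_span_singleton_self 1
    · have : b = 0 := by
        by_contra h
        rw [coeff_one, if_neg (Ne.symm h)] at hb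
        exact hb rfl
      simp [this]
  obtain ⟨G, c, hc, hG, hGf, hdvd⟩ := exists_isWeightMul_foldr hm ν (List.finRange (d + 1))
    (fun i _ hi => ⟨fun h => hi (h ▸ hνm), fun h => hi (hνS i h)⟩) hδ
    (f := weight (δ + ((List.finRange (d + 1)).map
      fun i => ν i • (Pi.single i 1 + Pi.single m 1)).sum)) (F := 1)
    (fun x _ => by simp) h1
  refine ⟨G, c, hc, ?_, fun x hx => ?_, ?_⟩
  · rwa [zero_add, ← Fin.sum_univ_def] at hG
  · rw [rodrigues, edgeDeriv, hexp, hGf x hx, ← mul_assoc, weight_neg_mul_weight δ hx, one_mul,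
      eval_onSimplex]
  · rwa [mul_one, ← Fin.prod_univ_def] at hdvd

theorem faceSpace_eq_map {δ : Fin (d + 1) → ℝ} {m : Fin (d + 1)} {S : Finset (Fin (d + 1))}
    (hm : m ∉ S) (hδ : -1 < δ m) (N : ℕ) :
    faceSpace δ m S N = (faceHarmonic δ S N).map onSimplex.toLinearMap := by
  refine le_antisymm (Submodule.span_le.2 ?_) ?_
  · rintro q ⟨ν, hνm, hνS, hνN, hq⟩
    obtain ⟨G, c, -, hG, hGq, -⟩ := exists_eval_eq_rodrigues hm hδ hνm hνS
    refine ⟨G, ?_, eq_of_eval_eq_on_openSimplex fun x hx => (hGq x hx).trans (hq x hx).symm⟩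
    rwa [← Int.ofNat_inj.1 hνN]
  · rintro _ ⟨G, hG, rfl⟩
    have hGS := mem_faceHarmonic.1 hG
    have hdeg : ∀ b ∈ G.support, ∑ i, b i = N := by
      intro b hb
      have h1 := hGS.1.1.degree_eq_sum_deg_support hb
      rw [h1]
      exact (Finset.sum_subset (Finset.subset_univ _) fun i _ hi => by simpa using hi).symm
    have hex : ∀ b : Fin (d + 1) →₀ ℕ, b ∈ {b ∈ G.support | b m = 0} →
        ∃ (R : MvPolynomial (Fin (d + 1)) ℝ) (c : ℝ), c ≠ 0 ∧ R ∈ faceHarmonic δ S N ∧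
        (∀ x ∈ openSimplex d, eval x (onSimplex R) = rodrigues δ m b x) ∧
        X m ∣ R - C c * ∏ i, X i ^ b i := by
      intro b hb
      rw [Finset.mem_filter] at hb
      have := exists_eval_eq_rodrigues hm hδ hb.2 (hGS.2 b (mem_support_iff.1 hb.1))
      rwa [hdeg b hb.1] at this
    choose! R c hc hR hRe hdvd using hex
    -- subtract the Rodrigues polynomials with the same restriction to the facet `y_m = 0`
    have hG0 : G - ∑ b ∈ G.support with b m = 0, (coeff b G / c b) • R b = 0 := by
      refine eq_zero_of_mem_harmonic_of_X_dvd hδ (n := N) (m := m)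
        (sub_mem hGS.1 (Submodule.sum_mem _ fun b hb =>
          Submodule.smul_mem _ _ (mem_faceHarmonic.1 (hR b hb)).1)) ?_
      have hsplit : G = ∑ b ∈ G.support with b m = 0, monomial b (coeff b G) +
          ∑ b ∈ G.support with ¬ b m = 0, monomial b (coeff b G) := by
        conv_lhs => rw [G.as_sum]
        exact (Finset.sum_filter_add_sum_filter_not _ _ _).symm
      have h1 : X m ∣ ∑ b ∈ G.support with ¬ b m = 0, monomial b (coeff b G) :=
        Finset.dvd_sum fun b hb => X_dvd_monomial.2 (Or.inr (Finset.mem_filter.1 hb).2)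
      have h2 : X m ∣ ∑ b ∈ G.support with b m = 0, ((coeff b G / c b) • R b -
          monomial b (coeff b G)) := by
        refine Finset.dvd_sum fun b hb => ?_
        have hmon : monomial b (coeff b G) = (coeff b G / c b) • (C (c b) * ∏ i, X i ^ b i) := by
          rw [smul_eq_C_mul, ← mul_assoc, ← C_mul, div_mul_cancel₀ _ (hc b hb), monomial_eq,
            Finsupp.prod_fintype _ _ (by simp)]
        rw [hmon, ← smul_sub, smul_eq_C_mul]
        exact (hdvd b hb).mul_left _
      have h3 := h1.sub h2
      convert h3 using 1
      conv_lhs => arg 1; rw [hsplit]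
      rw [Finset.sum_sub_distrib]
      abel
    rw [sub_eq_zero.1 hG0, map_sum]
    refine Submodule.sum_mem _ fun b hb => ?_
    rw [map_smul]
    refine Submodule.smul_mem _ _ (Submodule.subset_span ⟨b, ?_, ?_, ?_, hRe b hb⟩)
    · exact (Finset.mem_filter.1 hb).2
    · exact hGS.2 b (mem_support_iff.1 (Finset.mem_filter.1 hb).1)
    · rw [hdeg b (Finset.mem_filter.1 hb).1]

/-! ### Integration over the simplex -/

/-- The shear that replaces the sum of all `d + 1` coordinates by the last coordinate. -/
theorem measurePreserving_shear (d : ℕ) :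
    MeasurePreserving (fun p : (Fin d → ℝ) × ℝ => (p.1, p.2 - ∑ i, p.1 i))
      (volume.prod volume) (volume.prod volume) :=
  (MeasurePreserving.id volume).skew_product (g := fun (y : Fin d → ℝ) (t : ℝ) => t - ∑ i, y i)
    (by simp only [Function.uncurry_def]; fun_prop)
    (Filter.Eventually.of_forall fun y => (measurePreserving_sub_right volume (∑ i, y i)).map_eq)

/-- Dirichlet's integral, for functions `g i` on the half line that are homogeneous of degree `e i`:
the orthant is cut into the slices on which the coordinate sum is `t`, each of which is the simplex
scaled by `t`, and the integral over `t` is a Gamma integral. -/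
theorem integrable_and_integral_prod_bary {g : Fin (d + 1) → ℝ → ℝ} {e : Fin (d + 1) → ℝ}
    (hneg : ∀ i s, s < 0 → g i s = 0) (hhom : ∀ i s t, 0 < t → g i (t * s) = t ^ e i * g i s)
    (hint : ∀ i, Integrable fun s => Real.exp (-s) * g i s) (hE : 0 < (∑ i, e i) + d + 1) :
    Integrable (fun x : Fin d → ℝ => ∏ i, g i (bary x i)) ∧
      Real.Gamma ((∑ i, e i) + d + 1) * ∫ x : Fin d → ℝ, ∏ i, g i (bary x i) =
        ∏ i, ∫ s, Real.exp (-s) * g i s := by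
  set E := ∑ i, e i
  set J : (Fin d → ℝ) → ℝ := fun x => ∏ i, g i (bary x i) with hJ
  set h : Fin (d + 1) → ℝ → ℝ := fun i s => Real.exp (-s) * g i s with hh
  set Φ : (Fin d → ℝ) × ℝ → ℝ := fun p => (∏ i : Fin d, h i.castSucc (p.1 i)) * h (Fin.last d) p.2
  have hΦ : Integrable Φ (volume.prod volume) :=
    (Integrable.fintype_prod (f := fun i : Fin d => h i.castSucc)
      fun i => hint i.castSucc).mul_prod (hint (Fin.last d))
  have hΦi : ∫ p, Φ p ∂(volume.prod volume) = ∏ i, ∫ s, h i s := by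
    rw [integral_prod_mul (fun y : Fin d → ℝ => ∏ i : Fin d, h i.castSucc (y i)) (h (Fin.last d)),
      integral_fintype_prod_volume_eq_prod (fun i : Fin d => h i.castSucc), Fin.prod_univ_castSucc]
  set Ψ : (Fin d → ℝ) × ℝ → ℝ := fun p => Φ (p.1, p.2 - ∑ i, p.1 i)
  have hmp := measurePreserving_shear d
  have hΨ : Integrable Ψ (volume.prod volume) :=
    (hmp.integrable_comp hΦ.aestronglyMeasurable).2 hΦ
  have hΨi : ∫ p, Ψ p ∂(volume.prod volume) = ∏ i, ∫ s, h i s := by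
    have h1 := integral_map (f := Φ) hmp.measurable.aemeasurable
      (by rw [hmp.map_eq]; exact hΦ.aestronglyMeasurable)
    rw [hmp.map_eq] at h1
    rw [← hΦi, h1]
  -- on the slice of coordinate sum `t`, everything scales
  have hscale : ∀ t : ℝ, 0 < t → ∀ x : Fin d → ℝ,
      Ψ (t • x, t) = Real.exp (-t) * t ^ E * J x := by
    intro t ht x
    have h1 : Ψ (t • x, t) = ∏ i, h i (t * bary x i) := by
      simp [Ψ, Φ, Fin.prod_univ_castSucc, bary, ← Finset.mul_sum, mul_sub]
    rw [h1]
    simp only [hh, hhom _ _ _ ht, Finset.prod_mul_distrib, ← Real.exp_sum]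
    rw [Finset.sum_neg_distrib, ← Finset.mul_sum, sum_bary, mul_one,
      ← Real.rpow_sum_of_pos ht, mul_assoc]
  have hslice : ∀ t : ℝ, 0 < t →
      ∫ y, Ψ (y, t) = Real.exp (-t) * t ^ (E + d) * ∫ x, J x := by
    intro t ht
    have h1 := Measure.integral_comp_smul_of_nonneg volume (fun y => Ψ (y, t)) t (hR := ht.le)
    simp only [hscale t ht, integral_const_mul, Module.finrank_fin_fun, smul_eq_mul] at h1
    rw [Real.rpow_add_natCast ht.ne']
    have h2 : (t ^ d) ≠ 0 := (pow_pos ht d).ne'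
    field_simp at h1
    linear_combination -h1
  have hslice0 : ∀ t : ℝ, t < 0 → ∫ y, Ψ (y, t) = 0 := by
    intro t ht
    have : ∀ y, Ψ (y, t) = 0 := by
      intro y
      by_cases hy : ∀ i, 0 ≤ y i
      · have : t - ∑ i, y i < 0 := by
          have := Finset.sum_nonneg fun i (_ : i ∈ Finset.univ) => hy i
          linarith
        simp [Ψ, Φ, hh, hneg _ _ this]
      · push Not at hy
        obtain ⟨i, hi⟩ := hy
        simp only [Ψ, Φ]
        rw [Finset.prod_eq_zero (Finset.mem_univ i), zero_mul]
        simp [hh, hneg _ _ hi]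
    simp [this]
  constructor
  · have h1 : ∀ᵐ t : ℝ, Integrable fun y => Ψ (y, t) := hΨ.prod_left_ae
    have h2 : ∃ t : ℝ, 0 < t ∧ Integrable fun y => Ψ (y, t) := by
      by_contra hcon
      push Not at hcon
      have : volume (Set.Ioi (0 : ℝ)) = 0 :=
        measure_mono_null (fun t ht => hcon t ht) (ae_iff.1 h1)
      simp at this
    obtain ⟨t, ht, hti⟩ := h2
    have h3 := (integrable_comp_smul_iff volume (fun y => Ψ (y, t)) ht.ne').2 hti
    simp only [hscale t ht] at h3
    have hc : Real.exp (-t) * t ^ E ≠ 0 := by positivity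
    exact (integrable_const_mul_iff (IsUnit.mk0 _ hc) _).1 h3
  · have h1 : ∫ t in Set.Ioi (0 : ℝ), ∫ y, Ψ (y, t) = ∫ t, ∫ y, Ψ (y, t) := by
      refine setIntegral_eq_integral_of_ae_compl_eq_zero ?_
      have : ∀ᵐ t : ℝ, t ≠ 0 := by simp [ae_iff, measure_singleton]
      filter_upwards [this] with t ht ht'
      exact hslice0 t (lt_of_le_of_ne (not_lt.1 ht') ht)
    have h2 : ∫ t in Set.Ioi (0 : ℝ), ∫ y, Ψ (y, t) =
        ∫ t in Set.Ioi (0 : ℝ), Real.exp (-t) * t ^ (E + d + 1 - 1) * ∫ x, J x := by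
      refine setIntegral_congr_fun measurableSet_Ioi fun t ht => ?_
      simp only [hslice t ht, add_sub_cancel_right]
    rw [← hΨi, integral_prod_symm _ hΨ, ← h1, h2, Real.Gamma_eq_integral hE, integral_mul_const]

/-- `s ↦ s ^ a * s ^ n` on the half line `s ≥ 0`, extended by zero. -/
def halfPow (a : ℝ) (n : ℕ) : ℝ → ℝ := Set.indicator (Set.Ici 0) fun s => s ^ a * s ^ n

theorem halfPow_mul (a : ℝ) (n : ℕ) (s : ℝ) {t : ℝ} (ht : 0 < t) :
    halfPow a n (t * s) = t ^ (a + n) * halfPow a n s := by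
  by_cases hs : 0 ≤ s
  · have : 0 ≤ t * s := by positivity
    rw [halfPow, Set.indicator_of_mem (Set.mem_Ici.2 this), Set.indicator_of_mem (Set.mem_Ici.2 hs),
      Real.mul_rpow ht.le hs, mul_pow, Real.rpow_add_natCast ht.ne']
    ring
  · have : ¬ 0 ≤ t * s := by
      push Not at hs ⊢
      exact mul_neg_of_pos_of_neg ht hs
    rw [halfPow, Set.indicator_of_notMem (by simpa using this),
      Set.indicator_of_notMem (by simpa using hs), mul_zero]

theorem exp_mul_halfPow (a : ℝ) (n : ℕ) :
    (fun s => Real.exp (-s) * halfPow a n s) =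
      Set.indicator (Set.Ici 0) fun s => Real.exp (-s) * (s ^ a * s ^ n) := by
  ext s
  by_cases hs : 0 ≤ s <;> simp [halfPow, hs]

theorem eqOn_exp_mul (a : ℝ) (n : ℕ) :
    Set.EqOn (fun s : ℝ => Real.exp (-s) * (s ^ a * s ^ n))
      (fun s => Real.exp (-s) * s ^ (a + n + 1 - 1)) (Set.Ioi 0) := by
  intro s hs
  simp only
  rw [add_sub_cancel_right, Real.rpow_add_natCast (ne_of_gt hs)]

theorem integrable_exp_mul_halfPow {a : ℝ} (n : ℕ) (ha : 0 < a + n + 1) :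
    Integrable fun s => Real.exp (-s) * halfPow a n s := by
  rw [exp_mul_halfPow, integrable_indicator_iff measurableSet_Ici,
    integrableOn_Ici_iff_integrableOn_Ioi, integrableOn_congr_fun (eqOn_exp_mul a n)
      measurableSet_Ioi]
  exact Real.GammaIntegral_convergent ha

theorem integral_exp_mul_halfPow {a : ℝ} (n : ℕ) (ha : 0 < a + n + 1) :
    ∫ s, Real.exp (-s) * halfPow a n s = Real.Gamma (a + n + 1) := by
  rw [exp_mul_halfPow, integral_indicator measurableSet_Ici, integral_Ici_eq_integral_Ioi,
    setIntegral_congr_fun measurableSet_Ioi (eqOn_exp_mul a n), Real.Gamma_eq_integral ha]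

theorem measurableSet_simplex (d : ℕ) : MeasurableSet (simplex d) := by
  rw [simplex, Set.ofPred_forall]
  exact MeasurableSet.iInter fun i =>
    measurableSet_le measurable_const (continuous_bary_apply i).measurable

theorem prod_halfPow_bary (δ : Fin (d + 1) → ℝ) (b : Fin (d + 1) →₀ ℕ) :
    (fun x : Fin d → ℝ => ∏ i, halfPow (δ i) (b i) (bary x i)) =
      Set.indicator (simplex d) fun x => (∏ i, bary x i ^ b i) * weight δ x := by
  ext x
  by_cases hx : x ∈ simplex d
  · rw [Set.indicator_of_mem hx, weight, ← Finset.prod_mul_distrib]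
    refine Finset.prod_congr rfl fun i _ => ?_
    rw [halfPow, Set.indicator_of_mem (Set.mem_Ici.2 (hx i)), mul_comm]
  · rw [Set.indicator_of_notMem hx]
    have : ∃ i, ¬ 0 ≤ bary x i := not_forall.1 hx
    obtain ⟨i, hi⟩ := this
    refine Finset.prod_eq_zero (Finset.mem_univ i) ?_
    rw [halfPow, Set.indicator_of_notMem (by simpa using hi)]

/-- The linear functional `F ↦ ∫ F ∏ y_i^{δ_i} e^{-y_i} dy` over the orthant, defined by its moments
`∏ Γ(δ_i + b_i + 1)`. -/
def gammaMoment {σ : Type*} [Fintype σ] (δ : σ → ℝ) : MvPolynomial σ ℝ →ₗ[ℝ] ℝ :=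
  (basisMonomials σ ℝ).constr ℝ fun b => ∏ i, Real.Gamma (δ i + b i + 1)

theorem gammaMoment_monomial {σ : Type*} [Fintype σ] (δ : σ → ℝ) (b : σ →₀ ℕ) (r : ℝ) :
    gammaMoment δ (monomial b r) = r * ∏ i, Real.Gamma (δ i + b i + 1) := by
  have : (monomial b r : MvPolynomial σ ℝ) = r • basisMonomials σ ℝ b := by
    rw [coe_basisMonomials, smul_monomial, smul_eq_mul, mul_one]
  rw [this, map_smul, gammaMoment, Module.Basis.constr_basis, smul_eq_mul]

/-- Integration by parts in the variable `y_i`, on the level of moments. -/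
theorem gammaMoment_X_mul {σ : Type*} [Fintype σ] {δ : σ → ℝ} (hδ : ∀ i, -1 < δ i) (i : σ)
    (F : MvPolynomial σ ℝ) :
    gammaMoment δ (X i * F) = gammaMoment δ (X i * pderiv i F + C (δ i + 1) * F) := by
  classical
  induction F using MvPolynomial.induction_on' with
  | add p q hp hq => simp only [mul_add, map_add] at *; linarith
  | monomial b r =>
    rw [X_mul_pderiv_monomial, map_add, map_nsmul, ← smul_eq_C_mul, map_smul, mul_comm, X,
      monomial_mul, mul_one, gammaMoment_monomial, gammaMoment_monomial,
      ← Finset.mul_prod_erase _ _ (Finset.mem_univ i),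
      ← Finset.mul_prod_erase _ _ (Finset.mem_univ i)]
    have h1 : ∏ j ∈ Finset.univ.erase i, Real.Gamma (δ j + ((b + Finsupp.single i 1 : σ →₀ ℕ) j : ℕ) + 1) =
        ∏ j ∈ Finset.univ.erase i, Real.Gamma (δ j + b j + 1) :=
      Finset.prod_congr rfl fun j hj => by
        simp [Finsupp.single_eq_of_ne (Finset.ne_of_mem_erase hj)]
    have h2 : δ i + ((b + Finsupp.single i 1 : σ →₀ ℕ) i : ℕ) + 1 = (δ i + b i + 1) + 1 := by
      simp; ring
    have h3 : δ i + b i + 1 ≠ 0 := by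
      have := hδ i
      have : (0 : ℝ) ≤ b i := Nat.cast_nonneg _
      linarith
    rw [h1, h2, Real.Gamma_add_one h3, nsmul_eq_mul, smul_eq_mul]
    ring

/-- Green's formula for `Δ_δ` and the Gamma functional. The exponential factor contributes the Euler
operator, which produces the difference of the degrees. -/
theorem gammaMoment_green {σ : Type*} [Fintype σ] {δ : σ → ℝ} (hδ : ∀ i, -1 < δ i)
    {F G : MvPolynomial σ ℝ} {N M : ℕ} (hF : F.IsHomogeneous N) (hG : G.IsHomogeneous M) :
    gammaMoment δ (G * lapOp δ F - F * lapOp δ G) = ((N : ℝ) - M) * gammaMoment δ (F * G) := by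
  have h1 : G * lapOp δ F - F * lapOp δ G = ∑ i, (X i *
      pderiv i (G * pderiv i F - F * pderiv i G) +
        C (δ i + 1) * (G * pderiv i F - F * pderiv i G)) := by
    rw [lapOp_apply, lapOp_apply, Finset.mul_sum, Finset.mul_sum, ← Finset.sum_sub_distrib]
    refine Finset.sum_congr rfl fun i _ => ?_
    simp only [map_sub, pderiv_mul]
    ring
  rw [h1, map_sum]
  simp only [← gammaMoment_X_mul hδ]
  rw [← map_sum]
  have h2 : ∑ i, X i * (G * pderiv i F - F * pderiv i G) = ((N : ℝ) - M) • (F * G) := by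
    have eF := hF.sum_X_mul_pderiv
    have eG := hG.sum_X_mul_pderiv
    have : ∑ i, X i * (G * pderiv i F - F * pderiv i G) =
        G * ∑ i, X i * pderiv i F - F * ∑ i, X i * pderiv i G := by
      rw [Finset.mul_sum, Finset.mul_sum, ← Finset.sum_sub_distrib]
      exact Finset.sum_congr rfl fun i _ => by ring
    rw [this, eF, eG, sub_smul, Nat.cast_smul_eq_nsmul, Nat.cast_smul_eq_nsmul, mul_smul_comm,
      mul_smul_comm, mul_comm G F]
  rw [h2, map_smul, smul_eq_mul]

/-- Harmonic polynomials are orthogonal to all homogeneous polynomials of lower degree. -/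
theorem gammaMoment_mul_eq_zero {σ : Type*} [Fintype σ] {δ : σ → ℝ} (hδ : ∀ i, -1 < δ i)
    {F G : MvPolynomial σ ℝ} {N M : ℕ} (hF : F ∈ harmonic δ N) (hG : G.IsHomogeneous M)
    (hMN : M < N) : gammaMoment δ (F * G) = 0 := by
  rw [mem_harmonic] at hF
  have hne : (N : ℝ) - M ≠ 0 := by
    have : (M : ℝ) < N := by exact_mod_cast hMN
    linarith
  have hgreen : ∀ {M} {G : MvPolynomial σ ℝ}, G.IsHomogeneous M →
      -gammaMoment δ (F * lapOp δ G) = ((N : ℝ) - M) * gammaMoment δ (F * G) := by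
    intro M G hG
    rw [← gammaMoment_green hδ hF.1 hG, hF.2, mul_zero, zero_sub, map_neg]
  induction M generalizing G with
  | zero =>
    have h := hgreen hG
    rw [lapOp_eq_zero_of_isHomogeneous_zero hG, mul_zero, map_zero, neg_zero] at h
    exact (mul_eq_zero.1 h.symm).resolve_left hne
  | succ M ih =>
    have h := hgreen hG
    have hne' : (N : ℝ) - M ≠ 0 := by
      have : (M : ℝ) < N := by exact_mod_cast (by omega : M < N)
      linarith
    rw [ih (isHomogeneous_lapOp hG) (by omega) hne', neg_zero] at h
    exact (mul_eq_zero.1 h.symm).resolve_left hne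

theorem sum_param_gt {δ : Fin (d + 1) → ℝ} (hδ : ∀ i, -1 < δ i) : -1 < (∑ i, δ i) + d := by
  have : ∑ _i : Fin (d + 1), (-1 : ℝ) < ∑ i, δ i :=
    Finset.sum_lt_sum_of_nonempty Finset.univ_nonempty fun i _ => hδ i
  simp at this
  linarith

/-- Integration over the simplex is, degree by degree, a multiple of the Gamma functional. -/
theorem integrableOn_and_integral_simplex {δ : Fin (d + 1) → ℝ} (hδ : ∀ i, -1 < δ i)
    {F : MvPolynomial (Fin (d + 1)) ℝ} {N : ℕ} (hF : F.IsHomogeneous N) :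
    IntegrableOn (fun x => eval x (onSimplex F) * weight δ x) (simplex d) ∧
      Real.Gamma (N + ((∑ i, δ i) + d) + 1) *
        ∫ x in simplex d, eval x (onSimplex F) * weight δ x = gammaMoment δ F := by
  have hmon : ∀ b ∈ F.support,
      IntegrableOn (fun x => (∏ i, bary x i ^ b i) * weight δ x) (simplex d) ∧
      Real.Gamma (N + ((∑ i, δ i) + d) + 1) *
        ∫ x in simplex d, (∏ i, bary x i ^ b i) * weight δ x =
          ∏ i, Real.Gamma (δ i + b i + 1) := by
    intro b hb
    have hbN : ∑ i, b i = N := by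
      rw [hF.degree_eq_sum_deg_support hb]
      exact (Finset.sum_subset (Finset.subset_univ _) fun i _ hi => by simpa using hi).symm
    have hpos : ∀ i, 0 < δ i + b i + 1 := by
      intro i
      have := hδ i
      have : (0 : ℝ) ≤ b i := Nat.cast_nonneg _
      linarith
    have hE : ∑ i, (δ i + b i) = N + ∑ i, δ i := by
      rw [Finset.sum_add_distrib, ← hbN]; push_cast; ring
    have hE' : 0 < ∑ i, (δ i + b i) + (d : ℝ) + 1 := by
      have := sum_param_gt hδ
      have : (0 : ℝ) ≤ N := Nat.cast_nonneg _
      rw [hE]; linarith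
    have h := integrable_and_integral_prod_bary (g := fun i => halfPow (δ i) (b i))
      (e := fun i => δ i + b i)
      (fun i s hs => by rw [halfPow, Set.indicator_of_notMem (by simpa using hs)])
      (fun i s t ht => halfPow_mul _ _ _ ht)
      (fun i => integrable_exp_mul_halfPow _ (hpos i)) hE'
    simp only [integral_exp_mul_halfPow _ (hpos _)] at h
    rw [prod_halfPow_bary, integrable_indicator_iff (measurableSet_simplex d),
      integral_indicator (measurableSet_simplex d), hE] at h
    rwa [show (N : ℝ) + (∑ i, δ i + d) + 1 = N + ∑ i, δ i + d + 1 by ring]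
  have hfun : (fun x => eval x (onSimplex F) * weight δ x) = fun x => ∑ b ∈ F.support,
      coeff b F * ((∏ i, bary x i ^ b i) * weight δ x) := by
    ext x
    rw [eval_onSimplex, eval_eq', Finset.sum_mul]
    exact Finset.sum_congr rfl fun b _ => by ring
  rw [hfun]
  refine ⟨integrable_finsetSum _ fun b hb => (hmon b hb).1.const_mul _, ?_⟩
  rw [integral_finsetSum _ fun b hb => (hmon b hb).1.const_mul _, Finset.mul_sum]
  conv_rhs => rw [F.as_sum, map_sum]
  refine Finset.sum_congr rfl fun b hb => ?_
  rw [integral_const_mul, gammaMoment_monomial, ← (hmon b hb).2]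
  ring

/-! ### Orthogonal polynomials -/

theorem mem_polyLE_natCast {N : ℕ} {p : MvPolynomial (Fin d) ℝ} :
    p ∈ polyLE d N ↔ p.totalDegree ≤ N := by
  rw [polyLE, mem_restrictSupport_iff, totalDegree, Finset.sup_le_iff]
  simp only [Set.subset_def, Nat.cast_le]
  rfl

theorem polyLE_of_neg {N : ℤ} (hN : N < 0) : polyLE d N = ⊥ := by
  rw [eq_bot_iff]
  intro p hp
  ext b
  rw [coeff_zero]
  by_contra hb
  have h1 : ((b.degree : ℕ) : ℤ) ≤ N := hp (mem_support_iff.2 hb)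
  have h2 : (0 : ℤ) ≤ ((b.degree : ℕ) : ℤ) := Int.natCast_nonneg _
  omega

theorem orthoSpace_of_neg (δ : Fin (d + 1) → ℝ) {N : ℤ} (hN : N < 0) : orthoSpace δ N = ⊥ := by
  rw [eq_bot_iff, orthoSpace, Submodule.span_le]
  rintro p ⟨hp, -⟩
  rwa [polyLE_of_neg hN] at hp

/-- The weight is positive on the open simplex, so the inner product is definite. -/
theorem eq_zero_of_setIntegral_sq_eq_zero {δ : Fin (d + 1) → ℝ} {r : MvPolynomial (Fin d) ℝ}
    (hint : IntegrableOn (fun x => eval x r * eval x r * weight δ x) (simplex d))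
    (h : ∫ x in simplex d, eval x r * eval x r * weight δ x = 0) : r = 0 := by
  have hnn : 0 ≤ᵐ[volume.restrict (simplex d)] fun x => eval x r * eval x r * weight δ x := by
    filter_upwards [ae_restrict_mem (measurableSet_simplex d)] with x hx
    exact mul_nonneg (mul_self_nonneg _) (Finset.prod_nonneg fun i _ => Real.rpow_nonneg (hx i) _)
  have h0 := (setIntegral_eq_zero_iff_of_nonneg_ae hnn hint).1 h
  have hnull : volume {x ∈ openSimplex d | eval x r ≠ 0} = 0 := by
    rw [Filter.EventuallyEq, ae_restrict_iff' (measurableSet_simplex d), ae_iff] at h0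
    refine measure_mono_null (fun x hx => ?_) h0
    intro hcon
    have hw : 0 < weight δ x := Finset.prod_pos fun i _ => Real.rpow_pos_of_pos (hx.1 i) _
    have := hcon fun i => (hx.1 i).le
    exact mul_ne_zero (mul_ne_zero hx.2 hx.2) hw.ne' this
  have hopen : IsOpen {x ∈ openSimplex d | eval x r ≠ 0} :=
    (isOpen_openSimplex d).inter (isOpen_ne_fun (MvPolynomial.continuous_eval r) continuous_const)
  have hempty := (hopen.measure_eq_zero_iff volume).1 hnull
  refine eq_of_eval_eq_on_openSimplex fun x hx => ?_
  rw [map_zero]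
  by_contra hne
  have : x ∈ {x ∈ openSimplex d | eval x r ≠ 0} := ⟨hx, hne⟩
  rw [hempty] at this
  exact this

/-- For parameters greater than `-1`, the orthogonal polynomials of degree `N` are the restrictions of
the harmonic ones. -/
theorem orthoSpace_eq_map {δ : Fin (d + 1) → ℝ} (hδ : ∀ i, -1 < δ i) (N : ℕ) :
    orthoSpace δ N = (harmonic δ N).map onSimplex.toLinearMap := by
  have hI : ∀ {F G : MvPolynomial (Fin (d + 1)) ℝ} {N M : ℕ}, F.IsHomogeneous N →
      G.IsHomogeneous M →
      IntegrableOn (fun x => eval x (onSimplex F) * eval x (onSimplex G) * weight δ x) (simplex d) ∧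
      (gammaMoment δ (F * G) = 0 →
        ∫ x in simplex d, eval x (onSimplex F) * eval x (onSimplex G) * weight δ x = 0) := by
    intro F G N M hF hG
    have h := integrableOn_and_integral_simplex hδ (hF.mul hG)
    simp only [map_mul] at h
    refine ⟨h.1, fun h0 => ?_⟩
    rw [h0] at h
    refine (mul_eq_zero.1 h.2).resolve_left (Real.Gamma_pos_of_pos ?_).ne'
    have h1 := sum_param_gt hδ
    have h2 : (0 : ℝ) ≤ ((N + M : ℕ) : ℝ) := Nat.cast_nonneg _
    linarith
  have horth : ∀ {M : ℕ} {F : MvPolynomial (Fin (d + 1)) ℝ}, F ∈ harmonic δ (M + 1) →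
      ∀ q ∈ polyLE d (((M + 1 : ℕ) : ℤ) - 1),
      ∫ x in simplex d, eval x (onSimplex F) * eval x q * weight δ x = 0 := by
    intro M F hF q hq
    rw [show ((M + 1 : ℕ) : ℤ) - 1 = (M : ℕ) by push_cast; ring] at hq
    obtain ⟨G, hG, rfl⟩ := exists_isHomogeneous_onSimplex (mem_polyLE_natCast.1 hq)
    exact (hI hF.1 hG).2 (gammaMoment_mul_eq_zero hδ hF hG (Nat.lt_succ_self M))
  have hle : ∀ {N : ℕ} {F : MvPolynomial (Fin (d + 1)) ℝ}, F.IsHomogeneous N →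
      onSimplex F ∈ polyLE d N := fun hF =>
    mem_polyLE_natCast.2 ((totalDegree_onSimplex_le _).trans hF.totalDegree_le)
  refine le_antisymm (Submodule.span_le.2 ?_) ?_
  · rintro p ⟨hp, hpo⟩
    obtain ⟨P, hP, rfl⟩ := exists_isHomogeneous_onSimplex (mem_polyLE_natCast.1 hp)
    rcases N with _ | M
    · exact ⟨P, ⟨hP, lapOp_eq_zero_of_isHomogeneous_zero hP⟩, rfl⟩
    have hres : ∀ N < M + 1, ((M + 1 : ℕ) : ℝ) + N + (∑ i, δ i + d) ≠ 0 := by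
      intro N _
      have h1 := sum_param_gt hδ
      have h2 : (0 : ℝ) ≤ M := Nat.cast_nonneg _
      have h3 : (0 : ℝ) ≤ N := Nat.cast_nonneg _
      push_cast
      linarith
    have hP' : P ∈ homogeneousSubmodule (Fin (d + 1)) ℝ (M + 1) := hP
    rw [← (harmonic_sup_and_finrank hres).1] at hP'
    obtain ⟨H, hH, _, ⟨G, hG, rfl⟩, rfl⟩ := Submodule.mem_sup.1 hP'
    have hG' : G.IsHomogeneous M := hG
    have hsplit : onSimplex (H + LinearMap.mulLeft ℝ (∑ i, X i) G) = onSimplex H + onSimplex G := by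
      rw [map_add, LinearMap.mulLeft_apply, map_mul, onSimplex_sum_X, one_mul]
    rw [hsplit] at hpo ⊢
    have hGle : onSimplex G ∈ polyLE d (((M + 1 : ℕ) : ℤ) - 1) := by
      rw [show ((M + 1 : ℕ) : ℤ) - 1 = (M : ℕ) by push_cast; ring]
      exact hle hG'
    -- the lower order part is orthogonal to itself
    have hG0 : onSimplex G = 0 := by
      refine eq_zero_of_setIntegral_sq_eq_zero (hI hG' hG').1 ?_
      have h1 := hpo _ hGle
      have h2 := horth hH _ hGle
      simp only [map_add, add_mul] at h1
      rw [integral_add (hI hH.1 hG').1 (hI hG' hG').1, h2, zero_add] at h1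
      exact h1
    rw [hG0, add_zero]
    exact ⟨H, hH, rfl⟩
  · rintro _ ⟨F, hF, rfl⟩
    refine Submodule.subset_span ⟨hle hF.1, fun q hq => ?_⟩
    rcases N with _ | M
    · rw [polyLE_of_neg (by simp), Submodule.mem_bot] at hq
      simp [hq]
    · exact horth hF q hq

/-! ### The summands of the decomposition -/

theorem card_tail {k : ℕ} (hkd : k ≤ d + 1) : (tail d k).card = k := by
  have key : ∀ M m : ℕ, M = m + k →
      (Finset.univ.filter fun i : Fin M => m ≤ (i : ℕ)).card = k := by
    rintro _ m rfl
    rw [Finset.card_filter, Fin.sum_univ_add]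
    simp
  exact key _ _ (by omega)

theorem mem_tail {k : ℕ} {i : Fin (d + 1)} : i ∈ tail d k ↔ d + 1 - k ≤ (i : ℕ) := by
  simp [tail]

theorem sum_withTail_neg_one {k : ℕ} (hkd : k ≤ d + 1) (γ : Fin (d + 1 - k) → ℝ) :
    ∑ i, withTail γ (fun _ => -1) i = ∑ i, γ i - k := by
  have key : ∀ (M m : ℕ) (γ : Fin m → ℝ), M = m + k →
      ∑ i : Fin M, (if h : (i : ℕ) < m then γ ⟨i, h⟩ else -1) = ∑ i, γ i - k := by
    rintro _ m γ rfl
    rw [Fin.sum_univ_add]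
    simp [sub_eq_add_neg]
  exact key _ _ γ (by omega)

theorem summand_eq_map_harmonicPiece {k : ℕ} (hkd : k ≤ d + 1) {γ : Fin (d + 1 - k) → ℝ}
    (hγ : ∀ i, -1 < γ i) {p : Finset (Fin (d + 1)) → Fin (d + 1)}
    (hp : ∀ S, S ≠ Finset.univ → p S ∉ S) (n : ℕ) {A : Finset (Fin (d + 1))}
    (hA : A ⊆ tail d k) (hA' : tail d k \ A ≠ Finset.univ) :
    summand d k γ p n A =
      (harmonicPiece (withTail γ fun _ => -1) n (tail d k) A).map onSimplex.toLinearMap := by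
  have hmul : ∀ H : Submodule ℝ (MvPolynomial (Fin (d + 1)) ℝ),
      (H.map onSimplex.toLinearMap).map (LinearMap.mulLeft ℝ (∏ i ∈ A, baryPoly i)) =
      (H.map (LinearMap.mulLeft ℝ (∏ i ∈ A, X i))).map onSimplex.toLinearMap := by
    intro H
    rw [← Submodule.map_comp, ← Submodule.map_comp]
    congr 1
    refine LinearMap.ext fun F => ?_
    simp
  have hκ : ∀ i ∈ tail d k, withTail γ (fun _ => -1) i = -1 := by
    intro i hi
    rw [mem_tail] at hi
    rw [withTail, dif_neg (by omega)]
  have hpos : ∀ ε : Fin (d + 1) → ℝ, (∀ i, -1 < ε i) → ∀ i, -1 < withTail γ ε i := by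
    intro ε hε i
    rw [withTail]
    split_ifs
    · exact hγ _
    · exact hε i
  have hoff : ∀ ε : Fin (d + 1) → ℝ, ∀ i ∉ tail d k,
      withTail γ ε i = withTail γ (fun _ => -1) i := by
    intro ε i hi
    rw [mem_tail] at hi
    rw [withTail, withTail, dif_pos (by omega), dif_pos (by omega)]
  have hon : ∀ ε : Fin (d + 1) → ℝ, ∀ i ∈ tail d k, withTail γ ε i = ε i := by
    intro ε i hi
    rw [mem_tail] at hi
    rw [withTail, dif_neg (by omega)]
  rw [summand]
  by_cases hn : n < A.card
  · rw [harmonicPiece_eq_bot_of_lt hn, Submodule.map_bot]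
    have hz : (if A = tail d k then orthoSpace (withTail γ fun _ => 1) ((n : ℤ) - k)
        else faceSpace (withTail γ fun i => if i ∈ A then 1 else 0) (p (tail d k \ A))
          (tail d k \ A) ((n : ℤ) - A.card)) = ⊥ := by
      split_ifs with h
      · refine orthoSpace_of_neg _ ?_
        have := card_tail hkd
        rw [h] at hn
        omega
      · rw [eq_bot_iff, faceSpace, Submodule.span_le]
        rintro q ⟨ν, -, -, hν, -⟩
        have : (0 : ℤ) ≤ ((∑ i, ν i : ℕ) : ℤ) := Int.natCast_nonneg _
        omega
    rw [hz, Submodule.map_bot]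
  · obtain ⟨N, rfl⟩ := Nat.exists_eq_add_of_le' (not_lt.1 hn)
    split_ifs with h
    · have hN : ((N + A.card : ℕ) : ℤ) - k = (N : ℕ) := by
        rw [h, card_tail hkd]; push_cast; ring
      rw [hN, orthoSpace_eq_map (hpos _ fun _ => by norm_num), hmul,
        harmonicPiece_eq_map hκ hA (δ := withTail γ fun _ => 1)
          (fun i hi => by rw [hon _ i (hA hi)]) (hoff _) rfl]
      congr 2
      ext F
      rw [mem_faceHarmonic, h, Finset.sdiff_self]
      simp
    · have hN : ((N + A.card : ℕ) : ℤ) - A.card = (N : ℕ) := by push_cast; ring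
      have hδ : ∀ i, -1 < withTail γ (fun i => if i ∈ A then 1 else 0) i :=
        hpos _ fun i => by split_ifs <;> norm_num
      rw [hN, faceSpace_eq_map (hp _ hA') (hδ _), hmul,
        harmonicPiece_eq_map hκ hA (δ := withTail γ fun i => if i ∈ A then 1 else 0)
          (fun i hi => by rw [hon _ i (hA hi), if_pos hi]) (hoff _) rfl]

theorem finrank_map_harmonic {κ : Fin (d + 1) → ℝ} {n : ℕ}
    (hres : ∀ N < n, (n : ℝ) + N + (∑ i, κ i + d) ≠ 0) :
    Module.finrank ℝ ((harmonic κ n).map onSimplex.toLinearMap) = (n + d - 1).choose n := by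
  rw [finrank_map_onSimplex (n := n) (show harmonic κ n ≤ _ from inf_le_left)]
  rcases n with _ | n
  · rw [harmonic_zero, finrank_span_singleton one_ne_zero, Nat.choose_zero_right]
  · rw [(harmonic_sup_and_finrank hres).2, Nat.multichoose_eq, add_comm d]

/-- If all parameters are `-1`, the first order part of the operator vanishes. -/
theorem diffOp_eq_zero_of_linear {κ : Fin (d + 1) → ℝ} (hκ : ∀ i, κ i = -1)
    {u : MvPolynomial (Fin d) ℝ} {c : Fin d → ℝ}
    (hu : u ∈ Submodule.span ℝ (Set.range fun i : Fin d =>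
      (X i + C (c i) : MvPolynomial (Fin d) ℝ))) : diffOp κ u = 0 := by
  have h2 : ∀ i, ∃ r : ℝ, pderiv i u = C r := by
    intro i
    induction hu using Submodule.span_induction with
    | mem x hx =>
      obtain ⟨j, rfl⟩ := hx
      rcases eq_or_ne j i with rfl | h
      · exact ⟨1, by simp⟩
      · exact ⟨0, by simp [pderiv_X_of_ne h]⟩
    | zero => exact ⟨0, by simp⟩
    | add x y _ _ hx hy =>
      obtain ⟨a, ha⟩ := hx
      obtain ⟨b, hb⟩ := hy
      exact ⟨a + b, by rw [map_add, ha, hb, C_add]⟩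
    | smul a x _ hx =>
      obtain ⟨b, hb⟩ := hx
      exact ⟨a * b, by rw [Derivation.map_smul, hb, smul_eq_C_mul, C_mul]⟩
  have h3 : ∀ i j, pderiv i (pderiv j u) = 0 := by
    intro i j
    obtain ⟨r, hr⟩ := h2 j
    rw [hr, pderiv_C]
  simp [diffOp, h3, hκ]

theorem coeff_linear_combination (c a : Fin d → ℝ) (i : Fin d) :
    coeff (Finsupp.single i 1) (∑ j, a j • (X j + C (c j) : MvPolynomial (Fin d) ℝ)) = a i := by
  classical
  simp [coeff_sum, coeff_X, coeff_C, Finsupp.single_left_inj, Finset.sum_ite_eq,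
    (Finsupp.single_ne_zero.2 one_ne_zero).symm, eq_comm]

theorem linearIndependent_linear (c : Fin d → ℝ) :
    LinearIndependent ℝ fun i : Fin d => (X i + C (c i) : MvPolynomial (Fin d) ℝ) := by
  rw [Fintype.linearIndependent_iff]
  intro a h i
  rw [← coeff_linear_combination c a i, h, coeff_zero]

theorem totalDegree_of_mem_span_linear {c : Fin d → ℝ} {u : MvPolynomial (Fin d) ℝ}
    (hu : u ∈ Submodule.span ℝ (Set.range fun i : Fin d =>
      (X i + C (c i) : MvPolynomial (Fin d) ℝ))) (h0 : u ≠ 0) : u.totalDegree = 1 := by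
  obtain ⟨a, rfl⟩ := (Submodule.mem_span_range_iff_exists_fun ℝ).1 hu
  refine le_antisymm ?_ ?_
  · refine totalDegree_finsetSum_le fun i _ => (totalDegree_smul_le _ _).trans ?_
    exact (totalDegree_add _ _).trans (by simp)
  · obtain ⟨i, hi⟩ : ∃ i, a i ≠ 0 := by
      by_contra hcon
      push Not at hcon
      exact h0 (by simp [hcon])
    rw [← coeff_linear_combination c a i] at hi
    simpa using le_totalDegree (mem_support_iff.2 hi)

end SimplexPoly
end

theorem mainTheorem1 (d k n : ℕ) (hd : 1 ≤ d) (hk : 1 ≤ k) (hkd : k ≤ d + 1)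
    (γ : Fin (d + 1 - k) → ℝ) (hγ : ∀ i, -1 < γ i)
    (p : Finset (Fin (d + 1)) → Fin (d + 1)) (hp : ∀ S, S ≠ Finset.univ → p S ∉ S)
    (c : Fin d → ℝ) :
    ∃ U : Submodule ℝ (MvPolynomial (Fin d) ℝ),
      (∀ u ∈ U, SimplexPoly.diffOp (SimplexPoly.withTail γ fun _ => -1) u =
        (-((n : ℝ) * ((n : ℝ) + (∑ i, γ i) + (d : ℝ) - (k : ℝ)))) • u) ∧
      (∀ u ∈ U, u ≠ 0 → u.totalDegree = n) ∧
      Module.finrank ℝ U = (n + d - 1).choose n ∧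
      (k ≤ d ∨ 2 ≤ n → ∀ u : MvPolynomial (Fin d) ℝ,
        SimplexPoly.diffOp (SimplexPoly.withTail γ fun _ => -1) u =
          (-((n : ℝ) * ((n : ℝ) + (∑ i, γ i) + (d : ℝ) - (k : ℝ)))) • u → u ∈ U) ∧
      (n = 0 → U = Submodule.span ℝ {1}) ∧
      (k ≤ d → 1 ≤ n →
        U = (⨆ A : {A : Finset (Fin (d + 1)) // A ⊆ SimplexPoly.tail d k},
          SimplexPoly.summand d k γ p n A) ∧
        iSupIndep fun A : {A : Finset (Fin (d + 1)) // A ⊆ SimplexPoly.tail d k} =>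
          SimplexPoly.summand d k γ p n A) ∧
      (k = d + 1 → n = 1 →
        U = Submodule.span ℝ (Set.range fun i : Fin d =>
          (MvPolynomial.X i + MvPolynomial.C (c i) : MvPolynomial (Fin d) ℝ))) ∧
      (k = d + 1 → 2 ≤ n →
        U = (⨆ A : {A : Finset (Fin (d + 1)) // A ⊆ SimplexPoly.tail d k ∧ 2 ≤ A.card},
          SimplexPoly.summand d k γ p n A) ∧
        iSupIndep fun A : {A : Finset (Fin (d + 1)) //
            A ⊆ SimplexPoly.tail d k ∧ 2 ≤ A.card} =>
          SimplexPoly.summand d k γ p n A) := by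
  set κ := SimplexPoly.withTail γ fun _ => -1 with hκdef
  have hsum : ∑ i, κ i = ∑ i, γ i - k := SimplexPoly.sum_withTail_neg_one hkd γ
  have heig : (n : ℝ) * ((n : ℝ) + (∑ i, γ i) + (d : ℝ) - (k : ℝ)) = n * (n + ∑ i, κ i + d) := by
    rw [hsum]; ring
  rw [heig]
  have hκ : ∀ i ∈ SimplexPoly.tail d k, κ i = -1 := by
    intro i hi
    rw [SimplexPoly.mem_tail] at hi
    rw [hκdef, SimplexPoly.withTail, dif_neg (by omega)]
  have hs1 : -1 ≤ ∑ i, κ i + d := by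
    have h1 : ∑ _i : Fin (d + 1 - k), (-1 : ℝ) ≤ ∑ i, γ i := Finset.sum_le_sum fun i _ => (hγ i).le
    simp [Nat.cast_sub hkd] at h1
    rw [hsum]
    linarith
  have hs2 : k ≤ d → -1 < ∑ i, κ i + d := by
    intro hk'
    have : Nonempty (Fin (d + 1 - k)) := ⟨⟨0, by omega⟩⟩
    have h1 : ∑ _i : Fin (d + 1 - k), (-1 : ℝ) < ∑ i, γ i :=
      Finset.sum_lt_sum_of_nonempty Finset.univ_nonempty fun i _ => hγ i
    simp [Nat.cast_sub hkd] at h1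
    rw [hsum]
    linarith
  -- distinct eigenvalues, away from the exceptional pair of degrees zero and one
  have hres : k ≤ d ∨ 2 ≤ n → ∀ N, N ≠ n → (n : ℝ) + N + (∑ i, κ i + d) ≠ 0 := by
    intro h N hN
    rcases h with h | h
    · have h1 := hs2 h
      have h2 : (1 : ℝ) ≤ n + N := by exact_mod_cast (by omega : 1 ≤ n + N)
      linarith
    · have h2 : (2 : ℝ) ≤ n + N := by exact_mod_cast (by omega : 2 ≤ n + N)
      linarith
  by_cases hex : k = d + 1 ∧ n = 1
  · obtain ⟨hk', rfl⟩ := hex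
    have hall : ∀ i, κ i = -1 := fun i => hκ i (SimplexPoly.mem_tail.2 (by omega))
    have hev : ∑ i, κ i + d = -1 := by simp [hall]
    refine ⟨Submodule.span ℝ (Set.range fun i : Fin d =>
          (MvPolynomial.X i + MvPolynomial.C (c i) : MvPolynomial (Fin d) ℝ)), fun u hu => ?_,
      fun u hu h0 => SimplexPoly.totalDegree_of_mem_span_linear hu h0, ?_, by omega, by omega,
      by omega, fun _ _ => rfl, by omega⟩
    · rw [SimplexPoly.diffOp_eq_zero_of_linear hall hu, add_assoc, hev]
      simp
    · rw [finrank_span_eq_card (SimplexPoly.linearIndependent_linear c)]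
      simp
  have hlow : ∀ N < n, (n : ℝ) + N + (∑ i, κ i + d) ≠ 0 := by
    intro N hN
    exact hres (by omega) N hN.ne
  refine ⟨(SimplexPoly.harmonic κ n).map SimplexPoly.onSimplex.toLinearMap, ?_, ?_,
    SimplexPoly.finrank_map_harmonic hlow,
    fun h u hu => SimplexPoly.mem_map_harmonic_of_diffOp_eq (hres h) hu, ?_, ?_, ?_, ?_⟩
  · rintro _ ⟨F, hF, rfl⟩
    exact SimplexPoly.diffOp_of_mem_harmonic hF
  · rintro _ ⟨F, hF, rfl⟩ h0
    exact SimplexPoly.totalDegree_of_mem_harmonic hlow hF h0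
  · rintro rfl
    rw [SimplexPoly.harmonic_zero, Submodule.map_span, Set.image_singleton]
    simp
  · intro hk' hn
    have hsd : ∀ A, SimplexPoly.tail d k \ A ≠ Finset.univ := by
      intro A h
      have h0 : (0 : Fin (d + 1)) ∈ SimplexPoly.tail d k \ A := by rw [h]; simp
      have := SimplexPoly.mem_tail.1 (Finset.mem_sdiff.1 h0).1
      simp at this
      omega
    have heq : ∀ A : {A : Finset (Fin (d + 1)) // A ⊆ SimplexPoly.tail d k},
        SimplexPoly.summand d k γ p n A = (SimplexPoly.harmonicPiece κ n
          (SimplexPoly.tail d k) A).map SimplexPoly.onSimplex.toLinearMap := fun A =>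
      SimplexPoly.summand_eq_map_harmonicPiece hkd hγ hp n A.2 (hsd A)
    simp only [heq]
    exact ⟨SimplexPoly.map_harmonic_eq_iSup hκ n _ fun A h h' => absurd h h',
      SimplexPoly.iSupIndep_map_harmonicPiece _ _ _ _⟩
  · exact fun h1 h2 => absurd ⟨h1, h2⟩ hex
  · intro hk' hn
    have huniv : SimplexPoly.tail d k = Finset.univ := by
      ext i; simp [SimplexPoly.mem_tail]; omega
    have hall : ∀ i, κ i = -1 := fun i => hκ i (by rw [huniv]; simp)
    have heq : ∀ A : {A : Finset (Fin (d + 1)) // A ⊆ SimplexPoly.tail d k ∧ 2 ≤ A.card},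
        SimplexPoly.summand d k γ p n A = (SimplexPoly.harmonicPiece κ n
          (SimplexPoly.tail d k) A).map SimplexPoly.onSimplex.toLinearMap := fun A =>
      SimplexPoly.summand_eq_map_harmonicPiece hkd hγ hp n A.2.1 (by
        intro h
        have hcard : (0 : ℕ) < A.1.card := by have := A.2.2; omega
        obtain ⟨i, hi⟩ := Finset.card_pos.1 hcard
        have : i ∈ SimplexPoly.tail d k \ A := by rw [h]; simp
        exact (Finset.mem_sdiff.1 this).2 hi)
    simp only [heq]
    refine ⟨SimplexPoly.map_harmonic_eq_iSup hκ n _ fun A h h' => ?_,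
      SimplexPoly.iSupIndep_map_harmonicPiece _ _ _ _⟩
    rw [huniv]
    refine SimplexPoly.harmonicPiece_univ_eq_bot hall hn ?_
    by_contra hcon
    exact h' ⟨h, by omega⟩
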